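/- Let $(a_m)_{m\in\mathbb Z}$ be i.i.d. BPSK symbols ($a_m=\pm1$ with probability $1/2$), with kurtosis $\kappa=-2$, and let $T>0$ be the symbol period. For $W>0$ let $\mathcal F([-W,W])$ be the set of all $f\in L^2(\mathbb R)$ (complex valued) whose Fourier transform vanishes outside $[-W,W]$. For each excess bandwidth $\gamma\in[0,1)$ let $g_\gamma\in\mathcal F\big([-\tfrac{1+\gamma}{2T},\tfrac{1+\gamma}{2T}]\big)$ be a shaping filter whose Fourier transform is nonzero almost everywhere on this band, and let $T_e=T_e(\gamma)>0$ be a sampling period with $\frac1{T_e}>\frac{1+\gamma}{T}$ and $T_e\notin\{T,\frac T2,\frac T3,\frac{2T}3\}$. Put $s_\gamma(n)=\sum_{m}a_m\,g_\gamma(nT_e-mT)$ (convergence in mean square) and $\alpha=T_e/T$. Write $\langle u_n\rangle=\lim_{N\to\infty}\frac1{2N+1}\sum_{n=-N}^{N}u_n$, $R^{(\theta)}_x=\langle\mathbb E(|x(n)|^2)e^{-2i\pi n\theta}\rangle$, $R^{(\theta)}_{c,x}=\langle\mathbb E(x(n)^2)e^{-2i\pi n\theta}\rangle$, $c_4(x)=\mathbb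 E|x|^4-2(\mathbb E|x|^2)^2-|\mathbb E x^2|^2$, and $$\beta(x)=\langle c_4(x(n))\rangle+2+2\sum_{l=\pm1}\big|R_x^{(l\alpha)}\big|^2+\sum_{l=-1,0,1}\big|R_{c,x}^{(l\alpha)}\big|^2 .$$ Let $\beta_{\min}(\gamma)$ be the infimum of $\beta(x)$ over all filtered versions $x=[f(z)]s_\gamma$ of $s_\gamma$ (limits in mean square, uniformly in time, of outputs of filters with finite impulse response) of unit norm, i.e. with $\langle\mathbb E|x(n)|^2\rangle=1$. For $f\ne0$ put $$\Phi_0(f)=\kappa T\frac{\int|f|^4}{(\int|f|^2)^2}+2+\frac{|\int f^2|^2}{(\int|f|^2)^2},$$ $$\Phi(f)=\Phi_0(f)+4\left|\frac{\int|f(t)|^2e^{-2i\pi t/T}dt}{\int|f|^2}\right|^2+\frac{|\int f(t)^2e^{-2i\pi t/T}dt|^2}{(\int|f|^2)^2}+\frac{|\int f(t)^2e^{2i\pi t/T}dt|^2}{(\int|f|^2)^2},$$ all integrals being over $\mathbb R$. **Proposition.** 1. For each $\gamma\in[0,1)$, $\beta_{\min}(\gamma)=\inf\Phi(f)$ over nonzero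 $f\in\mathcal F([-\frac{1+\gamma}{2T},\frac{1+\gamma}{2T}])$ (so it does not depend on the choice of $g_\gamma$ and $T_e$), and $\gamma\mapsto\beta_{\min}(\gamma)$ is decreasing (non-increasing) on $[0,1)$. 2. Consequently $\beta_{\min}(\gamma)<2$ for all $\gamma\in[0,1)$ if and only if $\beta_{\min}(0)<2$. 3. For each $f\in\mathcal F([-\frac1{2T},\frac1{2T}])$ the integrals $\int|f(t)|^2e^{-2i\pi t/T}dt$, $\int f(t)^2e^{-2i\pi t/T}dt$ and $\int f(t)^2e^{2i\pi t/T}dt$ vanish, and $\beta_{\min}(0)=\inf\Phi_0(f)$ over nonzero $f\in\mathcal F([-\frac1{2T},\frac1{2T}])$. -/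

import Mathlib

open MeasureTheory ProbabilityTheory Filter Topology FourierTransform

noncomputable section

namespace CMA

/-! ### Band-limited functions -/

/-- `G` is a square integrable spectrum that vanishes outside `[-W, W]` and `f` is its inverse
Fourier transform, `f t = ∫ exp (2 π i ν t) G ν dν` (the integral converges absolutely, because
`G` is square integrable with bounded support). -/
def IsSpectrum (W : ℝ) (G f : ℝ → ℂ) : Prop :=
  MemLp G 2 volume ∧ (∀ ν, ν ∉ Set.Icc (-W) W → G ν = 0) ∧ f = 𝓕⁻ G

/-- The space `𝓕([-W, W])` of the functions of `L²(ℝ)` whose Fourier transform vanishes outside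
`[-W, W]`; each of them is represented by its continuous version. -/
def bandLimited (W : ℝ) : Set (ℝ → ℂ) :=
  {f | MemLp f 2 volume ∧ ∃ G, IsSpectrum W G f}

/-- Half-bandwidth `(1 + γ) / (2 T)` for the symbol period `T` and the excess bandwidth `γ`. -/
def halfBand (T γ : ℝ) : ℝ := (1 + γ) / (2 * T)

/-- A shaping filter with bandwidth `[-(1 + γ) / (2 T), (1 + γ) / (2 T)]`: an element of the
corresponding space whose spectrum fills the band (it is nonzero almost everywhere on it). -/
def IsShapingFilter (T γ : ℝ) (g : ℝ → ℂ) : Prop :=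
  MemLp g 2 volume ∧ ∃ G, IsSpectrum (halfBand T γ) G g ∧
    ∀ᵐ ν ∂(volume.restrict (Set.Icc (-halfBand T γ) (halfBand T γ))), G ν ≠ 0

/-- Sampling periods `Te` that satisfy the Shannon condition `1 / Te > (1 + γ) / T` and avoid the
exceptional values `T`, `T / 2`, `T / 3`, `2 T / 3`. -/
structure IsSamplingPeriod (T γ Te : ℝ) : Prop where
  pos : 0 < Te
  shannon : Te * (1 + γ) < T
  generic : Te ≠ T ∧ Te ≠ T / 2 ∧ Te ≠ T / 3 ∧ Te ≠ 2 * T / 3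

/-! ### BPSK symbols and the transmitted signal -/

variable {Ω : Type*} [MeasurableSpace Ω]

/-- A BPSK symbol sequence: independent symbols, equal to `1` or `-1` with probability `1 / 2`. -/
structure IsBPSK (a : ℤ → Ω → ℂ) (μ : Measure Ω) : Prop where
  measurable : ∀ m, Measurable (a m)
  indep : iIndepFun a μ
  values : ∀ m, ∀ᵐ ω ∂μ, a m ω = 1 ∨ a m ω = -1
  prob_one : ∀ m, μ {ω | a m ω = 1} = 1 / 2
  prob_neg_one : ∀ m, μ {ω | a m ω = -1} = 1 / 2

theorem IsBPSK.memLp {a : ℤ → Ω → ℂ} {μ : Measure Ω} [IsProbabilityMeasure μ]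
    (ha : IsBPSK a μ) (m : ℤ) : MemLp (a m) 2 μ := by
  refine MemLp.of_bound (ha.measurable m).aestronglyMeasurable 1 ?_
  filter_upwards [ha.values m] with ω hω
  rcases hω with h | h <;> simp [h]

/-- The symbols as elements of `L²(Ω)`. -/
def IsBPSK.symbol {a : ℤ → Ω → ℂ} {μ : Measure Ω} [IsProbabilityMeasure μ]
    (ha : IsBPSK a μ) (m : ℤ) : Lp ℂ 2 μ :=
  (ha.memLp m).toLp (a m)

variable {μ : Measure Ω}

/-- The linearly modulated signal `s_a(t) = ∑ₘ aₘ g(t - m T)`, a series that converges in mean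
square. -/
def linearModulation (T : ℝ) (g : ℝ → ℂ) (b : ℤ → Lp ℂ 2 μ) (t : ℝ) : Lp ℂ 2 μ :=
  ∑' m : ℤ, g (t - m * T) • b m

/-- The discrete-time signal `s(n) = s_a(n Te)`. -/
def sampledSignal (T Te : ℝ) (g : ℝ → ℂ) (b : ℤ → Lp ℂ 2 μ) (n : ℤ) : Lp ℂ 2 μ :=
  linearModulation T g b (n * Te)

/-! ### Filtering -/

/-- The output `∑ₗ pₗ s(n - l)` of the filter with the finite impulse response `p`. -/
def firOutput (p : ℤ →₀ ℂ) (s : ℤ → Lp ℂ 2 μ) (n : ℤ) : Lp ℂ 2 μ :=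
  p.sum fun l c => c • s (n - l)

/-- `r` is a filtered version `[f(z)] s` of `s`: a limit in mean square, uniformly in time, of
outputs of filters with finite impulse response. This covers all filters with a summable impulse
response and, for the signals considered here, is the same as being the output of a filter whose
transfer function is square integrable with respect to the spectral density of `s`. -/
def IsFiltered (s r : ℤ → Lp ℂ 2 μ) : Prop :=
  ∃ p : ℕ → (ℤ →₀ ℂ), TendstoUniformly (fun k n => firOutput (p k) s n) r atTop

/-! ### Second and fourth order statistics -/

/-- The time average `lim (1 / (2 N + 1)) ∑_{|n| ≤ N} u n`. -/
def timeMean {E : Type*} [NormedAddCommGroup E] [NormedSpace ℝ E] (u : ℤ → E) : E :=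
  limUnder atTop fun N : ℕ =>
    (1 / (2 * (N : ℝ) + 1)) • ∑ n ∈ Finset.Icc (-(N : ℤ)) (N : ℤ), u n

/-- The cyclo-correlation `R_x^{(α)}(m) = ⟨E (x(n + m) x(n)^* e^{-2 i π n α})⟩`. -/
def cyclicCorr (x : ℤ → Lp ℂ 2 μ) (α : ℝ) (m : ℤ) : ℂ :=
  timeMean fun n : ℤ =>
    ∫ ω, x (n + m) ω * starRingEnd ℂ (x n ω) * Complex.exp (-2 * Real.pi * Complex.I * n * α) ∂μ

/-- The non conjugate cyclo-correlation `R_{c,x}^{(α)}(m) = ⟨E (x(n + m) x(n) e^{-2 i π n α})⟩`. -/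
def ncCyclicCorr (x : ℤ → Lp ℂ 2 μ) (α : ℝ) (m : ℤ) : ℂ :=
  timeMean fun n : ℤ =>
    ∫ ω, x (n + m) ω * x n ω * Complex.exp (-2 * Real.pi * Complex.I * n * α) ∂μ

/-- The fourth order cumulant `cum {x, x^*, x, x^*}` of a zero mean random variable. -/
def cumulant4 (x : Lp ℂ 2 μ) : ℝ :=
  ∫ ω, ‖x ω‖ ^ 4 ∂μ - 2 * (∫ ω, ‖x ω‖ ^ 2 ∂μ) ^ 2 - ‖∫ ω, x ω ^ 2 ∂μ‖ ^ 2

/-- The mean power `⟨E |x(n)|²⟩`; for `x = [f(z)] s` it is the squared norm `‖f‖²` of the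
filter. -/
def meanPower (x : ℤ → Lp ℂ 2 μ) : ℝ :=
  timeMean fun n : ℤ => ∫ ω, ‖x n ω‖ ^ 2 ∂μ

/-- The coefficient `β(x)` of a unit power signal `x` whose cyclic frequencies are `0, ± α`. -/
def beta (α : ℝ) (x : ℤ → Lp ℂ 2 μ) : ℝ :=
  timeMean (fun n : ℤ => cumulant4 (x n)) + 2
    + 2 * (‖cyclicCorr x (-α) 0‖ ^ 2 + ‖cyclicCorr x α 0‖ ^ 2)
    + (‖ncCyclicCorr x (-α) 0‖ ^ 2 + ‖ncCyclicCorr x 0 0‖ ^ 2 + ‖ncCyclicCorr x α 0‖ ^ 2)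

/-- The infimum `β_min` of `β([f(z)] s(n))` over the unit norm filters, where `s` is the linearly
modulated signal with symbols `b`, symbol period `T` and shaping filter `g`, sampled with
period `Te`; its cyclic frequencies are `0, ± Te / T`. -/
def betaMin (T Te : ℝ) (g : ℝ → ℂ) (b : ℤ → Lp ℂ 2 μ) : ℝ :=
  sInf (beta (Te / T) '' {r | IsFiltered (sampledSignal T Te g b) r ∧ meanPower r = 1})

/-! ### The functionals of the analog filter -/

/-- The kurtosis of BPSK symbols. -/
def kappa : ℝ := -2

/-- `∫ |f|² e^{-2 i π c t} dt`. -/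
def cyclicInt (c : ℝ) (f : ℝ → ℂ) : ℂ :=
  ∫ t : ℝ, (‖f t‖ ^ 2 : ℝ) * Complex.exp (-2 * Real.pi * Complex.I * c * t)

/-- `∫ f² e^{-2 i π c t} dt`. -/
def ncCyclicInt (c : ℝ) (f : ℝ → ℂ) : ℂ :=
  ∫ t : ℝ, f t ^ 2 * Complex.exp (-2 * Real.pi * Complex.I * c * t)

/-- The functional `Φ`. -/
def Phi (T : ℝ) (f : ℝ → ℂ) : ℝ :=
  kappa * T * ((∫ t : ℝ, ‖f t‖ ^ 4) / (∫ t : ℝ, ‖f t‖ ^ 2) ^ 2) + 2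
    + 4 * ‖cyclicInt (1 / T) f / ((∫ t : ℝ, ‖f t‖ ^ 2 : ℝ) : ℂ)‖ ^ 2
    + ‖∫ t : ℝ, f t ^ 2‖ ^ 2 / (∫ t : ℝ, ‖f t‖ ^ 2) ^ 2
    + ‖ncCyclicInt (1 / T) f‖ ^ 2 / (∫ t : ℝ, ‖f t‖ ^ 2) ^ 2
    + ‖ncCyclicInt (-(1 / T)) f‖ ^ 2 / (∫ t : ℝ, ‖f t‖ ^ 2) ^ 2

/-- The functional `Φ` without the terms at the cyclic frequencies `± 1 / T`. -/
def PhiZero (T : ℝ) (f : ℝ → ℂ) : ℝ :=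
  kappa * T * ((∫ t : ℝ, ‖f t‖ ^ 4) / (∫ t : ℝ, ‖f t‖ ^ 2) ^ 2) + 2
    + ‖∫ t : ℝ, f t ^ 2‖ ^ 2 / (∫ t : ℝ, ‖f t‖ ^ 2) ^ 2

end CMA

end

/-! A signal modulated by `f` is a series in the orthonormal symbols with coefficients `f (n Te - m
T)`. A finite impulse response filter multiplies the spectrum `G` of `f` by a trigonometric
polynomial of period `1 / Te`. The supremum over `n` of the power and `∫ ‖G‖²` bound each other up
to constants, so limits in mean square, uniform in time, of the outputs are `L²` limits of the
spectra. The band is shorter than `1 / Te` and the shaping spectrum is nonzero almost everywhere on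
it, so the filtered spectra are dense in `L²` of the band. Hence the filtered versions of the signal
are the signals modulated by all band-limited functions (`isFiltered_sampledSignal_iff`), and `g`
and `Te` disappear from the problem.

The statistics of a sample at `t = n Te` are governed by the sums over `m` of `‖f (t - m T)‖²`, `f
(t - m T)²` and `‖f (t - m T)‖⁴`. Each is `T`-periodic in `t`; folding the spectrum modulo `1 / T`
and Parseval show that it is a trigonometric polynomial. As `W ≤ 1 / T`, the quadratic sums have
frequencies `j / T` with `|j| ≤ 1`, and the quartic one, being the quadratic sum of `f²`, has `|j| ≤
3`. The exceptional sampling periods are those that would alias such a frequency to zero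
(`IsSamplingPeriod.nonResonant`), so time averages over the samples equal averages over a period,
that is, `1 / T` times integrals over the line. Thus `β` of a unit power signal is `Φ` of its analog
filter, and `Φ` is invariant under positive scaling (`image_beta_eq_image_Phi`).

Monotonicity is then the nesting of the bands. With no excess bandwidth the band has length `1 / T`,
so `G` and its translate by `1 / T` overlap at one point only, and every term at the frequencies `±
1 / T` vanishes. -/

noncomputable section

namespace CMA

open Complex (I)
open scoped ComplexConjugate Convolution

/-! ### Oscillating exponentials -/

/-- The oscillation `exp (2 π i x)`. -/
def osc (x : ℝ) : ℂ := Complex.exp (2 * Real.pi * x * I)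

theorem osc_add (x y : ℝ) : osc (x + y) = osc x * osc y := by
  rw [osc, osc, osc, ← Complex.exp_add]; push_cast; ring_nf

@[simp] theorem osc_zero : osc 0 = 1 := by simp [osc]

@[simp] theorem norm_osc (x : ℝ) : ‖osc x‖ = 1 := by
  rw [osc]
  convert! Complex.norm_exp_ofReal_mul_I (2 * Real.pi * x) using 2
  push_cast; ring_nf

theorem osc_int (n : ℤ) : osc n = 1 := by
  rw [osc, Complex.exp_eq_one_iff]
  exact ⟨n, by push_cast; ring⟩

theorem osc_eq_one_iff (x : ℝ) : osc x = 1 ↔ ∃ n : ℤ, x = n := by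
  constructor
  · intro h
    rw [osc, Complex.exp_eq_one_iff] at h
    obtain ⟨n, hn⟩ := h
    refine ⟨n, ?_⟩
    have h2 : (2 * Real.pi * I : ℂ) ≠ 0 := Complex.two_pi_I_ne_zero
    have : (x : ℂ) = n := by
      apply mul_right_cancel₀ h2
      rw [← hn]; ring
    exact_mod_cast this
  · rintro ⟨n, rfl⟩
    exact osc_int n

theorem osc_neg (x : ℝ) : osc (-x) = conj (osc x) := by
  rw [osc, osc, ← Complex.exp_conj]
  simp [Complex.conj_ofNat]

@[fun_prop] theorem continuous_osc : Continuous osc := by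
  unfold osc; fun_prop

/-! ### Folding a spectrum of bounded support -/

/-- The left end points of the `2 L` intervals of length `1 / T` that make up
`[-L / T, L / T]`. -/
def foldShift (T : ℝ) (L k : ℕ) : ℝ := ((k : ℝ) - L) / T

theorem integral_eq_sum_foldShift {T : ℝ} (hT : 0 < T) (L : ℕ)
    {E : Type*} [NormedAddCommGroup E] [NormedSpace ℝ E] {h : ℝ → E} (hi : Integrable h)
    (h0 : ∀ ν, ν ∉ Set.Icc (-(L / T)) (L / T) → h ν = 0) :
    ∫ ν, h ν = ∑ k ∈ Finset.range (2 * L), ∫ ν in (0 : ℝ)..1 / T, h (ν + foldShift T L k) := by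
  have hL : -((L : ℝ) / T) ≤ L / T := by
    have : 0 ≤ (L : ℝ) / T := by positivity
    linarith
  have h1 : ∫ ν, h ν = ∫ ν in (-(L / T))..(L / T), h ν := by
    rw [intervalIntegral.integral_of_le hL, ← integral_Icc_eq_integral_Ioc]
    exact (setIntegral_eq_integral_of_forall_compl_eq_zero (fun x hx => h0 x hx)).symm
  have h2 := intervalIntegral.sum_integral_adjacent_intervals (a := foldShift T L) (n := 2 * L)
    (μ := volume) (f := h) (fun k _ => hi.intervalIntegrable)
  rw [h1]
  have e0 : foldShift T L 0 = -(L / T) := by simp [foldShift, neg_div]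
  have e1 : foldShift T L (2 * L) = L / T := by
    simp only [foldShift]; push_cast; ring
  rw [e0, e1] at h2
  rw [← h2]
  refine Finset.sum_congr rfl fun k _ => ?_
  rw [intervalIntegral.integral_comp_add_right]
  congr 1
  · simp
  · simp only [foldShift]; push_cast; ring

namespace IsSpectrum

variable {W T : ℝ} {G f : ℝ → ℂ}

theorem integrable (h : IsSpectrum W G f) : Integrable G := by
  have h1 : IntegrableOn G (Set.Icc (-W) W) := by
    have : MemLp G 2 (volume.restrict (Set.Icc (-W) W)) := h.1.restrict _
    exact this.integrable (by norm_num)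
  exact (integrableOn_iff_integrable_of_support_subset
    (fun x hx => by_contra fun hc => hx (h.2.1 x hc))).1 h1

theorem apply (h : IsSpectrum W G f) (t : ℝ) : f t = ∫ ν, osc (ν * t) * G ν := by
  rw [h.2.2, Real.fourierInv_eq']
  refine integral_congr_ae (ae_of_all _ fun ν => ?_)
  simp [osc, mul_comm]

theorem integrable_osc_mul (h : IsSpectrum W G f) (t : ℝ) :
    Integrable fun ν => osc (ν * t) * G ν := by
  refine (h.integrable.norm).mono' ?_ (ae_of_all _ fun ν => by simp)
  exact (Continuous.aestronglyMeasurable (by fun_prop)).mul h.integrable.aestronglyMeasurable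

theorem continuous (h : IsSpectrum W G f) : Continuous f := by
  have : f = fun t => ∫ ν, osc (ν * t) * G ν := funext h.apply
  rw [this]
  refine continuous_of_dominated (bound := fun ν => ‖G ν‖) (fun t => ?_) (fun t => ?_)
    h.integrable.norm (ae_of_all _ fun ν => ?_)
  · exact (h.integrable_osc_mul t).aestronglyMeasurable
  · exact ae_of_all _ fun ν => by simp
  · fun_prop

theorem mono {W' : ℝ} (h : IsSpectrum W G f) (hW : W ≤ W') : IsSpectrum W' G f := by
  refine ⟨h.1, fun ν hν => h.2.1 ν fun hc => hν ⟨?_, ?_⟩, h.2.2⟩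
  · linarith [hc.1]
  · linarith [hc.2]

end IsSpectrum

/-- The periodization of `G ν exp (2 π i ν t)` with period `1 / T`, on `[0, 1 / T]`. -/
def folded (T : ℝ) (L : ℕ) (G : ℝ → ℂ) (t ν : ℝ) : ℂ :=
  ∑ k ∈ Finset.range (2 * L), osc ((ν + foldShift T L k) * t) * G (ν + foldShift T L k)

/-- The coefficients of the trigonometric polynomial `∑ₘ |f (t - m T)|²`. -/
def corrCoeff (T : ℝ) (L : ℕ) (G : ℝ → ℂ) (k j : ℕ) : ℂ :=
  (1 / T : ℝ) * ∫ ν in (0 : ℝ)..1 / T, G (ν + foldShift T L k) * conj (G (ν + foldShift T L j))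

theorem memLp_folded {G : ℝ → ℂ} (hG : MemLp G 2) (T : ℝ) (L : ℕ) (t : ℝ) :
    MemLp (folded T L G t) 2 := by
  unfold folded
  refine memLp_finsetSum _ fun k _ => ?_
  have h1 : MemLp (fun ν => G (ν + foldShift T L k)) 2 :=
    hG.comp_measurePreserving (measurePreserving_add_right volume _)
  refine MemLp.of_le h1 ?_ (ae_of_all _ fun ν => by simp)
  exact (Continuous.aestronglyMeasurable (by fun_prop)).mul h1.aestronglyMeasurable

theorem integrable_shift_mul_conj {G : ℝ → ℂ} (hG : MemLp G 2) (a b : ℝ) :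
    Integrable fun ν => G (ν + a) * conj (G (ν + b)) := by
  have h1 : ∀ c, MemLp (fun ν => G (ν + c)) 2 := fun c =>
    hG.comp_measurePreserving (measurePreserving_add_right volume _)
  exact (h1 a).integrable_mul (h1 b).star

namespace IsSpectrum

variable {W T : ℝ} {G f : ℝ → ℂ} {L : ℕ}

/-- Moving `ν` by a multiple of `1 / T` changes the phase `ν m T` by an integer, so the translates
of `f` are, up to a factor, the Fourier coefficients of the periodized spectrum. -/
theorem apply_sub_int_mul (h : IsSpectrum W G f) (hT : 0 < T) (hW : W ≤ L / T) (t : ℝ) (m : ℤ) :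
    f (t - m * T) = ∫ ν in (0 : ℝ)..1 / T, osc (-(m * T * ν)) * folded T L G t ν := by
  rw [h.apply, integral_eq_sum_foldShift hT L (h.integrable_osc_mul _)]
  · rw [← intervalIntegral.integral_finsetSum]
    · refine intervalIntegral.integral_congr fun ν _ => ?_
      simp only [folded, Finset.mul_sum]
      refine Finset.sum_congr rfl fun k _ => ?_
      rw [← mul_assoc, ← osc_add]
      congr 1
      have : (ν + foldShift T L k) * (t - m * T)
          = (-(m * T * ν) + (ν + foldShift T L k) * t) + ((-(m * ((k : ℤ) - (L : ℤ))) : ℤ) : ℝ) := by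
        simp only [foldShift]; push_cast; field_simp; ring
      rw [this, osc_add _ ((_ : ℤ) : ℝ), osc_int, mul_one]
    · intro k _
      exact ((h.integrable_osc_mul (t - m * T)).comp_add_right _).intervalIntegrable
  · intro ν hν
    rw [(h.mono hW).2.1 ν hν, mul_zero]

theorem hasSum_norm_sq (h : IsSpectrum W G f) (hT : 0 < T) (hW : W ≤ L / T) (t : ℝ) :
    HasSum (fun m : ℤ => ‖f (t - m * T)‖ ^ 2)
      (1 / T * ∫ ν in (0 : ℝ)..1 / T, ‖folded T L G t ν‖ ^ 2) := by
  have hT' : (0 : ℝ) < 1 / T := by positivity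
  have key := hasSum_sq_fourierCoeffOn hT' ((memLp_folded h.1 T L t).restrict (Set.Ioc 0 (1 / T)))
  have hc : ∀ m : ℤ, fourierCoeffOn hT' (folded T L G t) m = T * f (t - m * T) := by
    intro m
    rw [fourierCoeffOn_eq_integral, h.apply_sub_int_mul hT hW]
    simp only [sub_zero, one_div_one_div, Complex.real_smul]
    congr 1
    refine intervalIntegral.integral_congr fun ν _ => ?_
    simp only [fourier_coe_apply, smul_eq_mul, osc]
    congr 2
    push_cast
    rw [sub_zero]
    field_simp
  simp only [hc] at key
  convert! key.mul_left ((1 / T) ^ 2) using 1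
  · ext m
    simp only [norm_mul, Complex.norm_real, Real.norm_eq_abs, abs_of_pos hT]
    field_simp
  · simp only [sub_zero, smul_eq_mul]; field_simp

/-- When the square of `folded` is expanded, the phase `ν t` cancels and only the shifts `(k - j) /
T` remain as frequencies in `t`. -/
theorem hasSum_norm_sq_corrCoeff (h : IsSpectrum W G f) (hT : 0 < T) (hW : W ≤ L / T) (t : ℝ) :
    HasSum (fun m : ℤ => ((‖f (t - m * T)‖ ^ 2 : ℝ) : ℂ))
      (∑ k ∈ Finset.range (2 * L), ∑ j ∈ Finset.range (2 * L),
        corrCoeff T L G k j * osc (((k : ℝ) - j) * t / T)) := by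
  convert! (Complex.hasSum_ofReal).2 (h.hasSum_norm_sq hT hW t) using 1
  push_cast
  rw [← intervalIntegral.integral_ofReal]
  have : ∀ ν, ((‖folded T L G t ν‖ ^ 2 : ℝ) : ℂ) = ∑ k ∈ Finset.range (2 * L),
      ∑ j ∈ Finset.range (2 * L), osc (((k : ℝ) - j) * t / T) *
        (G (ν + foldShift T L k) * conj (G (ν + foldShift T L j))) := by
    intro ν
    push_cast
    rw [← Complex.mul_conj', folded, map_sum, Finset.sum_mul_sum]
    refine Finset.sum_congr rfl fun k _ => Finset.sum_congr rfl fun j _ => ?_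
    rw [map_mul, ← osc_neg]
    have : ((k : ℝ) - j) * t / T
        = (ν + foldShift T L k) * t + -((ν + foldShift T L j) * t) := by
      simp only [foldShift]; field_simp; ring
    rw [this, osc_add]; ring
  simp only [this]
  rw [intervalIntegral.integral_finsetSum, Finset.mul_sum]
  · refine Finset.sum_congr rfl fun k _ => ?_
    rw [intervalIntegral.integral_finsetSum, Finset.mul_sum]
    · refine Finset.sum_congr rfl fun j _ => ?_
      rw [intervalIntegral.integral_const_mul, corrCoeff]
      push_cast; ring
    · exact fun j _ => ((integrable_shift_mul_conj h.1 _ _).const_mul _).intervalIntegrable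
  · refine fun k _ => (integrable_finsetSum _ fun j _ =>
      (integrable_shift_mul_conj h.1 _ _).const_mul _).intervalIntegrable

theorem integrable_norm_sq (h : IsSpectrum W G f) : Integrable fun ν => ‖G ν‖ ^ 2 :=
  h.1.integrable_norm_pow (by norm_num)

theorem sum_corrCoeff_self (h : IsSpectrum W G f) (hT : 0 < T) (hW : W ≤ L / T) :
    ∑ k ∈ Finset.range (2 * L), corrCoeff T L G k k = ((1 / T * ∫ ν, ‖G ν‖ ^ 2 : ℝ) : ℂ) := by
  rw [integral_eq_sum_foldShift hT L h.integrable_norm_sq, Finset.mul_sum]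
  · push_cast
    refine Finset.sum_congr rfl fun k _ => ?_
    rw [corrCoeff, ← intervalIntegral.integral_ofReal]
    push_cast
    congr 1
    refine intervalIntegral.integral_congr fun ν _ => ?_
    simp [Complex.mul_conj']
  · intro ν hν
    simp [(h.mono hW).2.1 ν hν]

/-- Cauchy–Schwarz over the `2 L` translates that make up `folded`. The bound is uniform in `t`; it
serves for square integrability, for the uniformity in time of filtering and for the lower bound on
`Phi`. -/
theorem tsum_norm_sq_le (h : IsSpectrum W G f) (hT : 0 < T) (hW : W ≤ L / T) (t : ℝ) :
    ∑' m : ℤ, ‖f (t - m * T)‖ ^ 2 ≤ 2 * L / T * ∫ ν, ‖G ν‖ ^ 2 := by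
  rw [(h.hasSum_norm_sq hT hW t).tsum_eq]
  have hi : ∀ k, IntervalIntegrable (fun ν => ‖G (ν + foldShift T L k)‖ ^ 2) volume 0 (1 / T) :=
    fun k => (h.integrable_norm_sq.comp_add_right _).intervalIntegrable
  have hsum : ∫ ν, ‖G ν‖ ^ 2 = ∑ k ∈ Finset.range (2 * L),
      ∫ ν in (0 : ℝ)..1 / T, ‖G (ν + foldShift T L k)‖ ^ 2 := by
    exact integral_eq_sum_foldShift hT L h.integrable_norm_sq
      (fun ν hν => by simp [(h.mono hW).2.1 ν hν])
  rw [hsum, ← intervalIntegral.integral_finsetSum fun k _ => hi k]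
  have : 2 * L / T * ∫ ν in (0 : ℝ)..1 / T, ∑ k ∈ Finset.range (2 * L),
        ‖G (ν + foldShift T L k)‖ ^ 2
      = 1 / T * ∫ ν in (0 : ℝ)..1 / T, 2 * L * ∑ k ∈ Finset.range (2 * L),
        ‖G (ν + foldShift T L k)‖ ^ 2 := by
    rw [intervalIntegral.integral_const_mul]; ring
  rw [this]
  refine mul_le_mul_of_nonneg_left ?_ (by positivity)
  refine intervalIntegral.integral_mono_on (by positivity) ?_ ?_ fun ν _ => ?_
  · exact ((memLp_folded h.1 T L t).integrable_norm_pow (by norm_num)).intervalIntegrable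
  · exact ((integrable_finsetSum _ fun k _ =>
      h.integrable_norm_sq.comp_add_right _).const_mul _).intervalIntegrable
  · have h1 : ‖folded T L G t ν‖ ≤ ∑ k ∈ Finset.range (2 * L), ‖G (ν + foldShift T L k)‖ := by
      refine (norm_sum_le _ _).trans_eq ?_
      simp
    have h2 := sq_sum_le_card_mul_sum_sq (s := Finset.range (2 * L))
      (f := fun k => ‖G (ν + foldShift T L k)‖)
    rw [Finset.card_range] at h2
    push_cast at h2
    exact (pow_le_pow_left₀ (norm_nonneg _) h1 2).trans h2

end IsSpectrum

/-! ### Integrals over the line and over a period -/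

theorem integral_eq_intervalIntegral_of_hasSum {T : ℝ} (hT : 0 < T) {h u : ℝ → ℂ}
    (hi : Integrable h) (hu : ∀ t, HasSum (fun m : ℤ => h (t - m * T)) (u t)) :
    ∫ t, h t = ∫ t in (0 : ℝ)..T, u t := by
  -- Rescaling to period `1`, for which the line is cut into integer translates of `[0, 1]`.
  set h' : ℝ → ℂ := fun s => h (s * T) with hh'
  have hi' : Integrable h' := hi.comp_mul_right' hT.ne'
  have h1 := hi'.hasSum_intervalIntegral_comp_add_int
  have h1n := hi'.norm.hasSum_intervalIntegral_comp_add_int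
  have h2 : HasSum (fun m : ℤ => ∫ s in (0 : ℝ)..1, h' (s + m))
      (∫ s in (0 : ℝ)..1, u (s * T)) := by
    simp only [intervalIntegral.integral_of_le zero_le_one]
    have hsum : ∀ s, HasSum (fun m : ℤ => h' (s + m)) (u (s * T)) := by
      intro s
      rw [← (Equiv.neg ℤ).hasSum_iff]
      convert! hu (s * T) using 2 with m
      simp only [hh', Function.comp_apply, Equiv.neg_apply]
      congr 1
      push_cast; ring
    have := hasSum_integral_of_summable_integral_norm
      (μ := volume.restrict (Set.Ioc (0 : ℝ) 1)) (F := fun (m : ℤ) s => h' (s + m))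
      (fun m => (hi'.comp_add_right _).integrableOn) ?_
    · convert! this using 1
      exact integral_congr_ae (ae_of_all _ fun s => (hsum s).tsum_eq.symm)
    · simpa only [intervalIntegral.integral_of_le zero_le_one] using h1n.summable
  have h3 := h1.unique h2
  rw [intervalIntegral.integral_comp_mul_right _ hT.ne'] at h3
  rw [hh', Measure.integral_comp_mul_right] at h3
  simp only [zero_mul, one_mul, abs_of_pos (inv_pos.2 hT)] at h3
  exact smul_right_injective ℂ (inv_pos.2 hT).ne' h3

theorem integral_osc_int_mul_div {T : ℝ} (hT : 0 < T) (n : ℤ) :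
    ∫ t in (0 : ℝ)..T, osc (n * t / T) = if n = 0 then (T : ℂ) else 0 := by
  split_ifs with hn
  · simp [hn]
  · have hTC : (T : ℂ) ≠ 0 := by exact_mod_cast hT.ne'
    have hc : (2 * Real.pi * n / T * I : ℂ) ≠ 0 := by
      have : (n : ℂ) ≠ 0 := by exact_mod_cast hn
      have := Complex.two_pi_I_ne_zero
      simp_all
    have h1 : ∀ t : ℝ, osc (n * t / T) = Complex.exp ((2 * Real.pi * n / T * I : ℂ) * t) := by
      intro t; rw [osc]; push_cast; ring_nf
    simp only [h1]
    rw [integral_exp_mul_complex hc]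
    have h2 := h1 T
    rw [mul_div_assoc, div_self hT.ne', mul_one, osc_int] at h2
    rw [← h2]; simp

namespace IsSpectrum

variable {W T : ℝ} {G f : ℝ → ℂ} {L : ℕ}

/-- Cutting `[-n, n]` into unit intervals turns `∫ ‖f‖²` into the integral over `[0, 1]` of a
partial sum over integer translates, which `tsum_norm_sq_le` bounds independently of `n`. -/
theorem memLp (h : IsSpectrum W G f) : MemLp f 2 := by
  obtain ⟨L, hL⟩ := exists_nat_ge W
  have hL' : W ≤ L / (1 : ℝ) := by simpa using hL
  have hb := h.tsum_norm_sq_le one_pos hL'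
  set C : ℝ := 2 * L / 1 * ∫ ν, ‖G ν‖ ^ 2
  refine (memLp_two_iff_integrable_sq_norm h.continuous.aestronglyMeasurable).2 ?_
  have hcont : Continuous fun t => ‖f t‖ ^ 2 := by have := h.continuous; fun_prop
  refine integrable_of_intervalIntegral_norm_bounded (l := atTop) (ι := ℕ)
    (a := fun n => -(n : ℝ)) (b := fun n => (n : ℝ)) C (fun n => hcont.integrableOn_Ioc)
    (tendsto_neg_atTop_atBot.comp tendsto_natCast_atTop_atTop) tendsto_natCast_atTop_atTop
    (Eventually.of_forall fun n => ?_)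
  have h2 := intervalIntegral.sum_integral_adjacent_intervals (a := fun k : ℕ => (k : ℝ) - n)
    (n := 2 * n) (μ := volume) (f := fun t => ‖f t‖ ^ 2)
    (fun k _ => hcont.intervalIntegrable _ _)
  have e : ((2 * n : ℕ) : ℝ) - n = n := by push_cast; ring
  simp only [e, Nat.cast_zero, zero_sub] at h2
  simp only [norm_pow, norm_norm]
  rw [← h2]
  have h3 : ∀ k : ℕ, ∫ t in ((k : ℝ) - n)..(((k + 1 : ℕ) : ℝ) - n), ‖f t‖ ^ 2
      = ∫ t in (0 : ℝ)..1, ‖f (t - ((n - k : ℤ) : ℝ) * 1)‖ ^ 2 := by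
    intro k
    have := intervalIntegral.integral_comp_add_right (a := (0 : ℝ)) (b := 1)
      (fun t => ‖f t‖ ^ 2) ((k : ℝ) - n)
    have e1 : (0 : ℝ) + (k - n) = k - n := by ring
    have e2 : (1 : ℝ) + (k - n) = ((k + 1 : ℕ) : ℝ) - n := by push_cast; ring
    rw [e1, e2] at this
    rw [← this]
    refine intervalIntegral.integral_congr fun t _ => ?_
    congr 3
    push_cast; ring
  simp only [h3]
  have hc3 : ∀ c : ℝ, Continuous fun t => ‖f (t - c)‖ ^ 2 := fun c => by
    have := h.continuous; fun_prop
  rw [← intervalIntegral.integral_finsetSum fun k _ => (hc3 _).intervalIntegrable _ _]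
  have hC : C = ∫ _ in (0 : ℝ)..1, C := by simp
  rw [hC]
  refine intervalIntegral.integral_mono_on zero_le_one ?_ (by simp) fun t _ => ?_
  · exact (continuous_finsetSum _ fun k _ => hc3 _).intervalIntegrable _ _
  · refine le_trans ?_ (hb t)
    have hinj : Function.Injective fun k : ℕ => (n - k : ℤ) := fun a b hab => by
      simp only at hab; omega
    have := (h.hasSum_norm_sq one_pos hL' t).summable.sum_le_tsum
      ((Finset.range (2 * n)).map ⟨_, hinj⟩) (fun m _ => by positivity)
    rwa [Finset.sum_map] at this

/-- The integral over the line unfolds to one period of a trigonometric polynomial, where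
orthogonality keeps the terms with `k - j = l`. -/
theorem integral_norm_sq_mul_osc (h : IsSpectrum W G f) (hT : 0 < T) (hW : W ≤ L / T) (l : ℤ) :
    ∫ t, ((‖f t‖ ^ 2 : ℝ) : ℂ) * osc (-(l * t / T))
      = T * ∑ k ∈ Finset.range (2 * L), ∑ j ∈ Finset.range (2 * L),
        if (k : ℤ) - j - l = 0 then corrCoeff T L G k j else 0 := by
  have hi : Integrable fun t => ((‖f t‖ ^ 2 : ℝ) : ℂ) * osc (-(l * t / T)) := by
    have h0 : Integrable fun t => ‖f t‖ ^ 2 := h.memLp.integrable_norm_pow (by norm_num)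
    refine h0.mono' ?_ (ae_of_all _ fun ν => by simp)
    have := h.continuous
    exact Continuous.aestronglyMeasurable (by fun_prop)
  rw [integral_eq_intervalIntegral_of_hasSum hT hi (u := fun t =>
    (∑ k ∈ Finset.range (2 * L), ∑ j ∈ Finset.range (2 * L),
        corrCoeff T L G k j * osc (((k : ℝ) - j) * t / T)) * osc (-(l * t / T)))]
  · simp only [Finset.sum_mul]
    rw [intervalIntegral.integral_finsetSum, Finset.mul_sum]
    · refine Finset.sum_congr rfl fun k _ => ?_
      rw [intervalIntegral.integral_finsetSum, Finset.mul_sum]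
      · refine Finset.sum_congr rfl fun j _ => ?_
        have : ∀ t : ℝ, corrCoeff T L G k j * osc (((k : ℝ) - j) * t / T) * osc (-(l * t / T))
            = corrCoeff T L G k j * osc (((k - j - l : ℤ) : ℝ) * t / T) := by
          intro t
          rw [mul_assoc, ← osc_add]
          congr 2; push_cast; ring
        simp only [this]
        rw [intervalIntegral.integral_const_mul, integral_osc_int_mul_div hT]
        split_ifs <;> ring
      · exact fun j _ => Continuous.intervalIntegrable (by fun_prop) _ _
    · exact fun j _ => Continuous.intervalIntegrable (by fun_prop) _ _
  · intro t
    have := (h.hasSum_norm_sq_corrCoeff hT hW t).mul_right (osc (-(l * t / T)))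
    convert! this using 2 with m
    congr 1
    have e : -(l * (t - m * T) / T) = -(l * t / T) + ((l * m : ℤ) : ℝ) := by
      push_cast; field_simp; ring
    rw [e, osc_add, osc_int, mul_one]

/-- Plancherel, read off from the case `l = 0` with the auxiliary period `1`: the diagonal
coefficients add up to the energy of the spectrum. -/
theorem integral_norm_sq_time (h : IsSpectrum W G f) : ∫ t, ‖f t‖ ^ 2 = ∫ ν, ‖G ν‖ ^ 2 := by
  obtain ⟨L, hL⟩ := exists_nat_ge W
  have hL' : W ≤ L / (1 : ℝ) := by simpa using hL
  have h1 := h.integral_norm_sq_mul_osc one_pos hL' 0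
  have h2 := h.sum_corrCoeff_self one_pos hL'
  simp only [Int.cast_zero, zero_mul, zero_div, neg_zero, osc_zero, mul_one,
    integral_complex_ofReal, Complex.ofReal_one, one_mul, sub_zero, sub_eq_zero,
    Nat.cast_inj, Finset.sum_ite_eq] at h1
  rw [Finset.sum_congr rfl fun k hk => if_pos hk] at h1
  rw [h1.symm] at h2
  have := Complex.ofReal_injective h2
  simpa using this

end IsSpectrum

/-! ### Time averages -/

/-- The sequence `u` has the time average `a`. -/
def HasTimeMean {E : Type*} [NormedAddCommGroup E] [NormedSpace ℝ E] (u : ℤ → E) (a : E) : Prop :=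
  Tendsto (fun N : ℕ => (1 / (2 * (N : ℝ) + 1)) • ∑ n ∈ Finset.Icc (-(N : ℤ)) (N : ℤ), u n)
    atTop (𝓝 a)

namespace HasTimeMean

variable {E : Type*} [NormedAddCommGroup E] [NormedSpace ℝ E] {u v : ℤ → E} {a b : E}

theorem timeMean_eq (h : HasTimeMean u a) : timeMean u = a := h.limUnder_eq

theorem add (hu : HasTimeMean u a) (hv : HasTimeMean v b) :
    HasTimeMean (fun n => u n + v n) (a + b) := by
  refine (Tendsto.add hu hv).congr fun N => ?_
  rw [Finset.sum_add_distrib, smul_add]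

theorem map {F : Type*} [NormedAddCommGroup F] [NormedSpace ℝ F] (hu : HasTimeMean u a)
    (A : E →L[ℝ] F) : HasTimeMean (fun n => A (u n)) (A a) := by
  refine ((A.continuous.tendsto a).comp hu).congr fun N => ?_
  simp

theorem const_mul {w : ℤ → ℂ} {d : ℂ} (hw : HasTimeMean w d) (c : ℂ) :
    HasTimeMean (fun n => c * w n) (c * d) := by
  refine (Tendsto.const_mul c hw).congr fun N => ?_
  rw [mul_smul_comm, Finset.mul_sum]

theorem finsetSum {ι : Type*} {s : Finset ι} {w : ι → ℤ → E} {d : ι → E}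
    (h : ∀ i ∈ s, HasTimeMean (w i) (d i)) :
    HasTimeMean (fun n => ∑ i ∈ s, w i n) (∑ i ∈ s, d i) := by
  refine (tendsto_finsetSum s h).congr fun N => ?_
  rw [Finset.sum_comm, Finset.smul_sum]

theorem le_of_forall_le {w : ℤ → ℝ} {d C : ℝ} (hw : HasTimeMean w d) (h : ∀ n, w n ≤ C) :
    d ≤ C := by
  refine le_of_tendsto hw (Eventually.of_forall fun N => ?_)
  have hN : (0 : ℝ) < 2 * N + 1 := by positivity
  have := Finset.sum_le_card_nsmul (Finset.Icc (-(N : ℤ)) N) w C (fun n _ => h n)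
  have hc : ((Finset.Icc (-(N : ℤ)) N).card : ℝ) = 2 * N + 1 := by
    rw [Int.card_Icc]
    have : ((N : ℤ) + 1 - -N).toNat = 2 * N + 1 := by omega
    rw [this]; push_cast; ring
  rw [nsmul_eq_mul, hc] at this
  rw [smul_eq_mul, one_div, inv_mul_le_iff₀ hN]
  exact this

end HasTimeMean

theorem hasTimeMean_osc (θ : ℝ) :
    HasTimeMean (fun n : ℤ => osc (n * θ)) (if osc θ = 1 then 1 else 0) := by
  have hcard : ∀ N : ℕ, ((Finset.Icc (-(N : ℤ)) N).card : ℝ) = 2 * N + 1 := fun N => by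
    rw [Int.card_Icc]
    have : ((N : ℤ) + 1 - -N).toNat = 2 * N + 1 := by omega
    rw [this]; push_cast; ring
  split_ifs with hθ
  · have h1 : ∀ n : ℤ, osc (n * θ) = 1 := by
      intro n
      obtain ⟨k, rfl⟩ := (osc_eq_one_iff θ).1 hθ
      have : (n : ℝ) * k = ((n * k : ℤ) : ℝ) := by push_cast; ring
      rw [this, osc_int]
    refine tendsto_const_nhds.congr fun N => ?_
    have hN : (2 * (N : ℝ) + 1) ≠ 0 := by positivity
    simp only [h1, Finset.sum_const, ← Nat.cast_smul_eq_nsmul ℝ, hcard, smul_smul]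
    rw [one_div_mul_cancel hN, one_smul]
  · have hz : osc θ - 1 ≠ 0 := sub_ne_zero.2 hθ
    -- The geometric sum telescopes, so it stays bounded and division by `2 N + 1` sends it to zero.
    have key : ∀ N : ℕ, (osc θ - 1) * ∑ n ∈ Finset.Icc (-(N : ℤ)) N, osc (n * θ)
        = osc ((N + 1) * θ) - osc (-(N * θ)) := by
      intro N
      induction N with
      | zero => simp
      | succ N ih =>
        have hs : Finset.Icc (-((N + 1 : ℕ) : ℤ)) ((N + 1 : ℕ) : ℤ)
            = insert (-((N : ℤ) + 1)) (insert ((N : ℤ) + 1) (Finset.Icc (-(N : ℤ)) N)) := by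
          ext x; simp only [Finset.mem_Icc, Finset.mem_insert]; omega
        rw [hs, Finset.sum_insert (by simp; omega), Finset.sum_insert (by simp), mul_add, mul_add,
          ih]
        have e1 : osc θ * osc ((((-((N : ℤ) + 1)) : ℤ) : ℝ) * θ) = osc (-(N * θ)) := by
          rw [← osc_add]; congr 1; push_cast; ring
        have e2 : osc θ * osc ((((N : ℤ) + 1 : ℤ) : ℝ) * θ)
            = osc ((((N + 1 : ℕ) : ℝ) + 1) * θ) := by
          rw [← osc_add]; congr 1; push_cast; ring
        rw [sub_mul, sub_mul, e1, e2]
        push_cast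
        have e3 : -((N : ℝ) + 1) * θ = -((N + 1) * θ) := by ring
        rw [e3]; ring
    have hb : ∀ N : ℕ, ‖(1 / (2 * (N : ℝ) + 1)) • ∑ n ∈ Finset.Icc (-(N : ℤ)) N, osc (n * θ)‖
        ≤ (2 / ‖osc θ - 1‖) * (1 / ((N : ℝ) + 1)) := by
      intro N
      have h1 : ‖∑ n ∈ Finset.Icc (-(N : ℤ)) N, osc (n * θ)‖ ≤ 2 / ‖osc θ - 1‖ := by
        rw [le_div_iff₀' (norm_pos_iff.2 hz), ← norm_mul, key]
        refine (norm_sub_le _ _).trans ?_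
        simp only [norm_osc]; norm_num
      rw [norm_smul, mul_comm]
      refine mul_le_mul h1 ?_ (norm_nonneg _) (by positivity)
      rw [Real.norm_of_nonneg (by positivity)]
      refine one_div_le_one_div_of_le (by positivity) ?_
      have : (0 : ℝ) ≤ N := by positivity
      linarith
    refine squeeze_zero_norm hb ?_
    simpa using tendsto_one_div_add_atTop_nhds_zero_nat.const_mul (2 / ‖osc θ - 1‖)

/-- The frequencies `j α` with `0 < |j| ≤ J` are not integers. -/
def NonResonant (α : ℝ) (J : ℕ) : Prop :=
  ∀ j : ℤ, j ≠ 0 → |j| ≤ J → osc (j * α) ≠ 1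

/-- Without resonance, averaging over the samples selects the same terms `k - j = l` as integration
over the line. The bound `2 L - 1 + |l|` is the largest possible value of `|k - j - l|`. -/
theorem IsSpectrum.hasTimeMean_norm_sq {W T Te : ℝ} {G f : ℝ → ℂ} {L J : ℕ}
    (h : IsSpectrum W G f) (hT : 0 < T) (hW : W ≤ L / T) (l : ℤ) (hJ : 2 * (L : ℤ) - 1 + |l| ≤ J)
    (hα : NonResonant (Te / T) J) :
    HasTimeMean (fun n : ℤ => ((∑' m : ℤ, ‖f (n * Te - m * T)‖ ^ 2 : ℝ) : ℂ)
        * osc (-(l * (n * Te) / T)))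
      ((1 / T : ℝ) * ∫ t, ((‖f t‖ ^ 2 : ℝ) : ℂ) * osc (-(l * t / T))) := by
  rw [h.integral_norm_sq_mul_osc hT hW l, ← mul_assoc]
  have hTC : ((1 / T : ℝ) : ℂ) * T = 1 := by
    rw [← Complex.ofReal_mul, one_div_mul_cancel hT.ne', Complex.ofReal_one]
  rw [hTC, one_mul]
  have h1 : ∀ n : ℤ, ((∑' m : ℤ, ‖f (n * Te - m * T)‖ ^ 2 : ℝ) : ℂ) * osc (-(l * (n * Te) / T))
      = ∑ k ∈ Finset.range (2 * L), ∑ j ∈ Finset.range (2 * L),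
        corrCoeff T L G k j * osc (n * (((k - j - l : ℤ) : ℝ) * (Te / T))) := by
    intro n
    rw [Complex.ofReal_tsum, (h.hasSum_norm_sq_corrCoeff hT hW _).tsum_eq]
    simp only [Finset.sum_mul]
    refine Finset.sum_congr rfl fun k _ => Finset.sum_congr rfl fun j _ => ?_
    rw [mul_assoc, ← osc_add]
    congr 2; push_cast; ring
  simp only [h1]
  refine HasTimeMean.finsetSum fun k hk => HasTimeMean.finsetSum fun j hj => ?_
  have h2 := (hasTimeMean_osc (((k - j - l : ℤ) : ℝ) * (Te / T))).const_mul (corrCoeff T L G k j)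
  convert! h2 using 1
  by_cases hz : (k : ℤ) - j - l = 0
  · rw [if_pos hz, if_pos (by simp [hz]), mul_one]
  · rw [if_neg hz, if_neg, mul_zero]
    refine hα _ hz (le_trans ?_ hJ)
    rw [Finset.mem_range] at hk hj
    have := abs_sub ((k : ℤ) - j) l
    have : |(k : ℤ) - j| ≤ 2 * L - 1 := abs_le.2 ⟨by omega, by omega⟩
    linarith

/-! ### Operations on band-limited functions -/

namespace IsSpectrum

variable {W : ℝ} {G f G' f' : ℝ → ℂ}

theorem of_apply (hG : MemLp G 2) (h0 : ∀ ν, ν ∉ Set.Icc (-W) W → G ν = 0)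
    (hf : ∀ t, f t = ∫ ν, osc (ν * t) * G ν) : IsSpectrum W G f := by
  have h : IsSpectrum W G (𝓕⁻ G) := ⟨hG, h0, rfl⟩
  have : f = 𝓕⁻ G := funext fun t => by rw [hf, h.apply]
  rwa [this]

theorem mem_bandLimited (h : IsSpectrum W G f) : f ∈ bandLimited W := ⟨h.memLp, G, h⟩

theorem add (h : IsSpectrum W G f) (h' : IsSpectrum W G' f') :
    IsSpectrum W (fun ν => G ν + G' ν) (fun t => f t + f' t) := by
  refine of_apply (h.1.add h'.1) (fun ν hν => by simp [h.2.1 ν hν, h'.2.1 ν hν]) fun t => ?_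
  rw [h.apply, h'.apply, ← integral_add (h.integrable_osc_mul t) (h'.integrable_osc_mul t)]
  simp only [mul_add]

theorem const_mul (h : IsSpectrum W G f) (c : ℂ) :
    IsSpectrum W (fun ν => c * G ν) (fun t => c * f t) := by
  refine of_apply (h.1.const_mul c) (fun ν hν => by simp [h.2.1 ν hν]) fun t => ?_
  rw [h.apply, ← integral_const_mul]
  simp only [mul_left_comm]

theorem sub (h : IsSpectrum W G f) (h' : IsSpectrum W G' f') :
    IsSpectrum W (fun ν => G ν - G' ν) (fun t => f t - f' t) := by
  have := h.add (h'.const_mul (-1))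
  simpa only [neg_one_mul, ← sub_eq_add_neg] using this

theorem zero (W : ℝ) : IsSpectrum W (fun _ => 0) (fun _ => 0) :=
  of_apply MemLp.zero (fun _ _ => rfl) (by simp)

theorem finsetSum {ι : Type*} {s : Finset ι} {Γ φ : ι → ℝ → ℂ}
    (h : ∀ i ∈ s, IsSpectrum W (Γ i) (φ i)) :
    IsSpectrum W (fun ν => ∑ i ∈ s, Γ i ν) (fun t => ∑ i ∈ s, φ i t) := by
  classical
  induction s using Finset.induction_on with
  | empty => simpa using zero W
  | insert i s hi ih =>
    simp only [Finset.sum_insert hi]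
    exact (h i (Finset.mem_insert_self i s)).add
      (ih fun j hj => h j (Finset.mem_insert_of_mem hj))

theorem conjugate (h : IsSpectrum W G f) :
    IsSpectrum W (fun ν => conj (G (-ν))) (fun t => conj (f t)) := by
  have h1 : MemLp (fun ν => G (-ν)) 2 :=
    h.1.comp_measurePreserving (Measure.measurePreserving_neg volume)
  refine of_apply h1.star (fun ν hν => ?_) fun t => ?_
  · rw [h.2.1 (-ν), map_zero]
    exact fun hc => hν ⟨by linarith [hc.2], by linarith [hc.1]⟩
  · rw [h.apply, ← integral_conj, ← integral_neg_eq_self]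
    refine integral_congr_ae (ae_of_all _ fun ν => ?_)
    simp only [map_mul, ← osc_neg]
    congr 2; ring

theorem translate (h : IsSpectrum W G f) (c : ℝ) :
    IsSpectrum W (fun ν => osc (-(c * ν)) * G ν) (fun t => f (t - c)) := by
  refine of_apply ?_ (fun ν hν => by simp [h.2.1 ν hν]) fun t => ?_
  · refine h.1.of_le ?_ (ae_of_all _ fun ν => by simp)
    exact (Continuous.aestronglyMeasurable (by fun_prop)).mul h.1.aestronglyMeasurable
  · rw [h.apply]
    refine integral_congr_ae (ae_of_all _ fun ν => ?_)
    simp only [← mul_assoc, ← osc_add]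
    congr 2; ring

/-- The self-convolution is integrable and, by `2 x y ≤ x² + y²`, bounded by the energy of `G`;
together these make it square integrable. -/
theorem sq (h : IsSpectrum W G f) :
    IsSpectrum (2 * W) (G ⋆[ContinuousLinearMap.mul ℂ ℂ] G) (fun t => f t ^ 2) := by
  have hGi := h.integrable
  have hint : Integrable (G ⋆[ContinuousLinearMap.mul ℂ ℂ] G) := hGi.integrable_convolution _ hGi
  have happ : ∀ x, (G ⋆[ContinuousLinearMap.mul ℂ ℂ] G) x = ∫ y, G y * G (x - y) := fun x => by
    simp [convolution]
  set C : ℝ := ∫ ν, ‖G ν‖ ^ 2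
  have hbound : ∀ x, ‖(G ⋆[ContinuousLinearMap.mul ℂ ℂ] G) x‖ ≤ C := by
    intro x
    rw [happ]
    have h1 := h.integrable_norm_sq
    have h2 : Integrable fun y => ‖G (x - y)‖ ^ 2 := h1.comp_sub_left x
    have h3 : C = ∫ y, (‖G y‖ ^ 2 + ‖G (x - y)‖ ^ 2) / 2 := by
      rw [integral_div, integral_add h1 h2, integral_sub_left_eq_self (fun y => ‖G y‖ ^ 2)]
      ring
    rw [h3]
    refine norm_integral_le_of_norm_le ((h1.add h2).div_const 2) (ae_of_all _ fun y => ?_)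
    rw [norm_mul]
    nlinarith [sq_nonneg (‖G y‖ - ‖G (x - y)‖)]
  refine ⟨?_, fun x hx => ?_, ?_⟩
  · refine (memLp_two_iff_integrable_sq_norm hint.aestronglyMeasurable).2 ?_
    refine (hint.norm.const_mul C).mono' (hint.aestronglyMeasurable.norm.pow 2)
      (ae_of_all _ fun x => ?_)
    rw [Real.norm_of_nonneg (by positivity), pow_two]
    exact mul_le_mul_of_nonneg_right (hbound x) (norm_nonneg _)
  · rw [happ]
    refine integral_eq_zero_of_ae (ae_of_all _ fun y => ?_)
    by_cases hy : y ∈ Set.Icc (-W) W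
    · have : x - y ∉ Set.Icc (-W) W := fun hc => hx ⟨by linarith [hy.1, hc.1],
        by linarith [hy.2, hc.2]⟩
      simp [h.2.1 _ this]
    · simp [h.2.1 _ hy]
  · ext t
    rw [h.2.2, Real.fourierInv_eq_fourier_neg, Real.fourierInv_eq_fourier_neg,
      Real.fourier_mul_convolution_eq hGi hGi, pow_two]

/-- The spectrum can be cut off outside the band. -/
theorem of_memLp (W : ℝ) (hG : MemLp G 2) :
    IsSpectrum W ((Set.Icc (-W) W).indicator G) (𝓕⁻ ((Set.Icc (-W) W).indicator G)) :=
  ⟨hG.indicator measurableSet_Icc, fun _ hν => Set.indicator_of_notMem hν _, rfl⟩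

end IsSpectrum

/-! ### Second and fourth order time averages of the samples -/

/-- Reduces the averages of `f²` to averages of squared moduli: the conjugate of `f` has the same
symmetric band, so the four combinations remain in it. -/
theorem sq_eq_polarization (z : ℂ) :
    z ^ 2 = 1 / 4 * (((‖z + conj z‖ ^ 2 : ℝ) : ℂ)) + -(1 / 4) * ((‖z + -1 * conj z‖ ^ 2 : ℝ) : ℂ)
      + I / 4 * ((‖z + I * conj z‖ ^ 2 : ℝ) : ℂ) + -(I / 4) * ((‖z + -I * conj z‖ ^ 2 : ℝ) : ℂ) := by
  simp only [← Complex.normSq_eq_norm_sq, Complex.normSq_apply]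
  apply Complex.ext <;> simp [pow_two] <;> ring

section means

variable {W T Te : ℝ} {G f : ℝ → ℂ}

theorem IsSpectrum.integrable_norm_sq_mul_osc (h : IsSpectrum W G f) (l : ℤ) :
    Integrable fun t => ((‖f t‖ ^ 2 : ℝ) : ℂ) * osc (-(l * t / T)) := by
  have h0 : Integrable fun t => ‖f t‖ ^ 2 := h.memLp.integrable_norm_pow (by norm_num)
  refine h0.mono' ?_ (ae_of_all _ fun ν => by simp)
  have := h.continuous
  exact Continuous.aestronglyMeasurable (by fun_prop)

theorem IsSpectrum.summable_norm_sq (h : IsSpectrum W G f) (hT : 0 < T) (t : ℝ) :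
    Summable fun m : ℤ => ‖f (t - m * T)‖ ^ 2 := by
  obtain ⟨L, hL⟩ := exists_nat_ge (W * T)
  exact (h.hasSum_norm_sq hT ((le_div_iff₀ hT).2 hL) t).summable

theorem IsSpectrum.integral_sq_mul_osc (h : IsSpectrum W G f) (l : ℤ) :
    ∫ t, f t ^ 2 * osc (-(l * t / T))
      = 1 / 4 * (∫ t, ((‖f t + conj (f t)‖ ^ 2 : ℝ) : ℂ) * osc (-(l * t / T)))
        + -(1 / 4) * (∫ t, ((‖f t + -1 * conj (f t)‖ ^ 2 : ℝ) : ℂ) * osc (-(l * t / T)))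
        + I / 4 * (∫ t, ((‖f t + I * conj (f t)‖ ^ 2 : ℝ) : ℂ) * osc (-(l * t / T)))
        + -(I / 4) * (∫ t, ((‖f t + -I * conj (f t)‖ ^ 2 : ℝ) : ℂ) * osc (-(l * t / T))) := by
  have h1 := h.add h.conjugate
  have h2 := h.add (h.conjugate.const_mul (-1))
  have h3 := h.add (h.conjugate.const_mul I)
  have h4 := h.add (h.conjugate.const_mul (-I))
  have i1 := (h1.integrable_norm_sq_mul_osc (T := T) l).const_mul (1 / 4)
  have i2 := (h2.integrable_norm_sq_mul_osc (T := T) l).const_mul (-(1 / 4))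
  have i3 := (h3.integrable_norm_sq_mul_osc (T := T) l).const_mul (I / 4)
  have i4 := (h4.integrable_norm_sq_mul_osc (T := T) l).const_mul (-(I / 4))
  have : ∀ t, f t ^ 2 * osc (-(l * t / T)) = _ := fun t => by
    rw [sq_eq_polarization (f t), add_mul, add_mul, add_mul, mul_assoc, mul_assoc, mul_assoc,
      mul_assoc]
  simp only [this]
  have e := integral_add ((i1.add i2).add i3) i4
  have e' := integral_add (i1.add i2) i3
  have e'' := integral_add i1 i2
  simp only [Pi.add_apply] at e e' e''
  rw [e, e', e'']
  simp only [integral_const_mul]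

theorem IsSpectrum.hasTimeMean_sq (h : IsSpectrum W G f) (hT : 0 < T) (hW : W ≤ 1 / T) (l : ℤ)
    (hl : |l| ≤ 2) (hα : NonResonant (Te / T) 3) :
    HasTimeMean (fun n : ℤ => (∑' m : ℤ, f (n * Te - m * T) ^ 2) * osc (-(l * (n * Te) / T)))
      ((1 / T : ℝ) * ∫ t, f t ^ 2 * osc (-(l * t / T))) := by
  have hW' : W ≤ (1 : ℕ) / T := by simpa using hW
  have hJ : 2 * ((1 : ℕ) : ℤ) - 1 + |l| ≤ (3 : ℕ) := by push_cast; linarith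
  have h1 := h.add h.conjugate
  have h2 := h.add (h.conjugate.const_mul (-1))
  have h3 := h.add (h.conjugate.const_mul I)
  have h4 := h.add (h.conjugate.const_mul (-I))
  have m1 := (h1.hasTimeMean_norm_sq hT hW' l hJ hα).const_mul (1 / 4)
  have m2 := (h2.hasTimeMean_norm_sq hT hW' l hJ hα).const_mul (-(1 / 4))
  have m3 := (h3.hasTimeMean_norm_sq hT hW' l hJ hα).const_mul (I / 4)
  have m4 := (h4.hasTimeMean_norm_sq hT hW' l hJ hα).const_mul (-(I / 4))
  convert! ((m1.add m2).add m3).add m4 using 1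
  · ext n
    have s1 := (Complex.hasSum_ofReal.2 (h1.summable_norm_sq hT (n * Te)).hasSum).mul_left (1 / 4)
    have s2 := (Complex.hasSum_ofReal.2
      (h2.summable_norm_sq hT (n * Te)).hasSum).mul_left (-(1 / 4))
    have s3 := (Complex.hasSum_ofReal.2 (h3.summable_norm_sq hT (n * Te)).hasSum).mul_left (I / 4)
    have s4 := (Complex.hasSum_ofReal.2
      (h4.summable_norm_sq hT (n * Te)).hasSum).mul_left (-(I / 4))
    have s := ((s1.add s2).add s3).add s4
    simp only [← sq_eq_polarization] at s
    rw [s.tsum_eq]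
    ring
  · rw [h.integral_sq_mul_osc]
    ring

/-- The quadratic result applied to `f²`, whose band is twice as wide. Here `L = 2`, so frequencies
up to `2 L - 1 = 3` occur. -/
theorem IsSpectrum.hasTimeMean_norm_pow_four (h : IsSpectrum W G f) (hT : 0 < T) (hW : W ≤ 1 / T)
    (hα : NonResonant (Te / T) 3) :
    HasTimeMean (fun n : ℤ => ∑' m : ℤ, ‖f (n * Te - m * T)‖ ^ 4) (1 / T * ∫ t, ‖f t‖ ^ 4) := by
  have hW' : 2 * W ≤ (2 : ℕ) / T := by
    have : ((2 : ℕ) : ℝ) / T = 2 * (1 / T) := by push_cast; ring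
    rw [this]; linarith
  have h1 := (h.sq.hasTimeMean_norm_sq hT hW' 0 (J := 3) (by simp) hα).map Complex.reCLM
  have e4 : ∀ z : ℂ, ‖z ^ 2‖ ^ 2 = ‖z‖ ^ 4 := fun z => by rw [norm_pow, ← pow_mul]
  simp only [Int.cast_zero, zero_mul, zero_div, neg_zero, osc_zero, mul_one, e4,
    integral_complex_ofReal, ← Complex.ofReal_mul, Complex.reCLM_apply, Complex.ofReal_re] at h1
  exact h1

end means

/-- Since `0 < Te < T`, a resonance `j Te = n T` with `0 < j ≤ 3` forces `0 < n < j`, which leaves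
only the ratios `1/2`, `1/3` and `2/3`. -/
theorem IsSamplingPeriod.nonResonant {T γ Te : ℝ} (hT : 0 < T) (hγ : 0 ≤ γ)
    (h : IsSamplingPeriod T γ Te) : NonResonant (Te / T) 3 := by
  intro j hj hj3 hosc
  obtain ⟨n, hn⟩ := (osc_eq_one_iff _).1 hosc
  obtain ⟨h1, h2, h3, h4⟩ := h.generic
  have hlt : Te < T := by nlinarith [h.shannon, h.pos]
  have hn' : (j : ℝ) * Te = n * T := by
    field_simp at hn; linarith
  have hpos := h.pos
  have key : ∀ j n : ℤ, 0 < j → j ≤ 3 → (j : ℝ) * Te = n * T → False := by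
    intro j n hj0 hj3 hjn
    have hjR : (0 : ℝ) < j := by exact_mod_cast hj0
    have hn0 : 0 < n := by
      have : (0 : ℝ) < n * T := by rw [← hjn]; positivity
      exact_mod_cast pos_of_mul_pos_left this hT.le
    have hnj : n < j := by
      have : (n : ℝ) * T < j * T := by rw [← hjn]; exact mul_lt_mul_of_pos_left hlt hjR
      exact_mod_cast lt_of_mul_lt_mul_right this hT.le
    interval_cases j
    · omega
    · have : n = 1 := by omega
      subst this; push_cast at hjn; exact h2 (by linarith)
    · have : n = 1 ∨ n = 2 := by omega
      rcases this with rfl | rfl <;> push_cast at hjn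
      · exact h3 (by linarith)
      · exact h4 (by linarith)
  push_cast at hj3
  rcases lt_or_gt_of_ne hj with hneg | hp
  · refine key (-j) (-n) (by omega) (by rw [abs_of_neg hneg] at hj3; exact hj3) ?_
    push_cast; linarith
  · exact key j n hp (by rw [abs_of_pos hp] at hj3; exact hj3) hn'

/-! ### Norms in `L²` as integrals -/

theorem norm_sq_eq_integral {Ω : Type*} [MeasurableSpace Ω] {μ : Measure Ω} (x : Lp ℂ 2 μ) :
    ‖x‖ ^ 2 = ∫ ω, ‖x ω‖ ^ 2 ∂μ := by
  rw [← inner_self_eq_norm_sq (𝕜 := ℂ), L2.inner_def, ← integral_re (L2.integrable_inner _ _)]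
  simp only [inner_self_eq_norm_sq]

theorem norm_sq_toLp_sub {Ω : Type*} [MeasurableSpace Ω] {μ : Measure Ω} {u v : Ω → ℂ}
    (hu : MemLp u 2 μ) (hv : MemLp v 2 μ) :
    ‖hu.toLp u - hv.toLp v‖ ^ 2 = ∫ ω, ‖u ω - v ω‖ ^ 2 ∂μ := by
  rw [← MemLp.toLp_sub, norm_sq_eq_integral]
  refine integral_congr_ae ?_
  filter_upwards [(hu.sub hv).coeFn_toLp] with ω hω
  rw [hω, Pi.sub_apply]

/-! ### Density of the spectra of filtered signals -/

/-- Integration against `F` of functions of period `P`. -/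
def periodicIntegral (P : ℝ) [Fact (0 < P)] {F : ℝ → ℂ} (hF : Integrable F) :
    C(AddCircle P, ℂ) →L[ℂ] ℂ :=
  LinearMap.mkContinuous
    { toFun := fun ψ => ∫ ν : ℝ, ψ (ν : AddCircle P) * F ν
      map_add' := fun ψ φ => by
        have hi : ∀ ψ : C(AddCircle P, ℂ), Integrable fun ν : ℝ => ψ (ν : AddCircle P) * F ν :=
          fun ψ => hF.bdd_mul (c := ‖ψ‖)
            (ψ.continuous.comp (AddCircle.continuous_mk' P)).aestronglyMeasurable
            (ae_of_all _ fun ν => ψ.norm_coe_le_norm _)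
        rw [← integral_add (hi ψ) (hi φ)]
        simp only [ContinuousMap.add_apply, add_mul]
      map_smul' := fun c ψ => by
        simp only [ContinuousMap.smul_apply, smul_eq_mul, mul_assoc, integral_const_mul,
          RingHom.id_apply] }
    (∫ ν, ‖F ν‖) fun ψ => by
      rw [LinearMap.coe_mk, AddHom.coe_mk, mul_comm, ← integral_const_mul]
      refine norm_integral_le_of_norm_le (hF.norm.const_mul _) (ae_of_all _ fun ν => ?_)
      rw [norm_mul]
      exact mul_le_mul_of_nonneg_right (ψ.norm_coe_le_norm _) (norm_nonneg _)

/-- Integration against `F` vanishes on the Fourier monomials, hence on all continuous functions of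
period `1 / Te`. As the support of `F` lies strictly inside one period, these include enough test
functions to force `F = 0`. -/
theorem ae_eq_zero_of_integral_osc_mul_eq_zero {B Te : ℝ} (hTe : 0 < Te) (hB : 2 * B * Te < 1)
    {F : ℝ → ℂ} (hF : Integrable F) (h0 : ∀ ν, ν ∉ Set.Icc (-B) B → F ν = 0)
    (h : ∀ l : ℤ, ∫ ν, osc (l * Te * ν) * F ν = 0) : F =ᵐ[volume] 0 := by
  have hP : Fact ((0 : ℝ) < 1 / Te) := ⟨by positivity⟩
  have hBP : B < 1 / Te / 2 := by
    rw [div_div, lt_div_iff₀ (by positivity)]; linarith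
  have hL : periodicIntegral (1 / Te) hF = 0 := by
    have hd : Dense ((Submodule.span ℂ (Set.range (@fourier (1 / Te))) :
        Submodule ℂ C(AddCircle (1 / Te), ℂ)) : Set C(AddCircle (1 / Te), ℂ)) := by
      rw [Submodule.dense_iff_topologicalClosure_eq_top]
      exact span_fourier_closure_eq_top
    refine ContinuousLinearMap.ext_on hd ?_
    rintro _ ⟨l, rfl⟩
    rw [zero_apply, ← h l]
    refine integral_congr_ae (ae_of_all _ fun ν => ?_)
    simp only [fourier_coe_apply, osc]
    congr 2
    push_cast
    field_simp
  have hU := IsOpen.ae_eq_zero_of_integral_contDiff_smul_eq_zero (μ := volume)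
    (isOpen_Ioo (a := -(1 / Te / 2)) (b := 1 / Te / 2)) (f := F)
    (hF.locallyIntegrable.locallyIntegrableOn _) ?_
  · filter_upwards [hU] with ν hν
    by_cases hc : ν ∈ Set.Icc (-B) B
    · exact hν ⟨by linarith [hc.1], by linarith [hc.2]⟩
    · exact h0 ν hc
  · intro g hg _ hsupp
    have hend : ∀ x, x ∉ Set.Ioo (-(1 / Te / 2)) (1 / Te / 2) → g x = 0 := fun x hx =>
      image_eq_zero_of_notMem_tsupport fun hc => hx (hsupp hc)
    -- The periodic extension is continuous because `g` vanishes at both ends of the period.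
    have hcont : Continuous (AddCircle.liftIco (1 / Te) (-(1 / Te / 2)) fun x => (g x : ℂ)) := by
      refine AddCircle.liftIco_continuous ?_ ?_
      · rw [hend _ (by simp), hend _ (by simp)]
      · exact (Complex.continuous_ofReal.comp hg.continuous).continuousOn
    have hz := congrArg (fun A => A (⟨_, hcont⟩ : C(AddCircle (1 / Te), ℂ))) hL
    simp only [zero_apply] at hz
    rw [← hz]
    refine integral_congr_ae (ae_of_all _ fun ν => ?_)
    simp only [Complex.real_smul, ContinuousMap.coe_mk]
    by_cases hc : ν ∈ Set.Icc (-B) B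
    · rw [AddCircle.liftIco_coe_apply]
      exact ⟨by linarith [hc.1], by linarith [hc.2]⟩
    · rw [h0 ν hc]; simp

/-- The transfer function of the filter with the finite impulse response `p`. -/
def transfer (Te : ℝ) (p : ℤ →₀ ℂ) (ν : ℝ) : ℂ := p.sum fun l c => c * osc (-(l * Te * ν))

/-- Density by orthogonality: if `u` is orthogonal to every modulation of `G`, then `conj u * G`
vanishes almost everywhere, so `u` vanishes on the band, where `G ≠ 0`, and is orthogonal to `H`. -/
theorem exists_transfer_approx {B Te : ℝ} (hTe : 0 < Te) (hB : 2 * B * Te < 1) {G H : ℝ → ℂ}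
    (hG : MemLp G 2) (hG0 : ∀ ν, ν ∉ Set.Icc (-B) B → G ν = 0)
    (hne : ∀ᵐ ν ∂(volume.restrict (Set.Icc (-B) B)), G ν ≠ 0)
    (hH : MemLp H 2) (hH0 : ∀ ν, ν ∉ Set.Icc (-B) B → H ν = 0) {ε : ℝ} (hε : 0 < ε) :
    ∃ p : ℤ →₀ ℂ, ∫ ν, ‖transfer Te p ν * G ν - H ν‖ ^ 2 < ε := by
  have hm : ∀ l : ℤ, MemLp (fun ν => osc (-(l * Te * ν)) * G ν) 2 := fun l =>
    hG.of_le ((Continuous.aestronglyMeasurable (by fun_prop)).mul hG.aestronglyMeasurable)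
      (ae_of_all _ fun ν => by simp)
  set v : ℤ → Lp ℂ 2 (volume : Measure ℝ) := fun l => (hm l).toLp _ with hv
  set K := Submodule.span ℂ (Set.range v)
  have hmem : hH.toLp H ∈ K.topologicalClosure := by
    rw [← Submodule.orthogonal_orthogonal_eq_closure, Submodule.mem_orthogonal]
    intro u hu
    rw [Submodule.mem_orthogonal] at hu
    have hB0 : MeasurableSet (Set.Icc (-B) B) := measurableSet_Icc
    have huG : Integrable fun ν => conj (u ν) * G ν := (Lp.memLp u).star.integrable_mul hG
    have hzero := ae_eq_zero_of_integral_osc_mul_eq_zero hTe hB huG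
      (fun ν hν => by simp [hG0 ν hν]) fun l => by
        have h1 := hu (v (-l)) (Submodule.subset_span ⟨-l, rfl⟩)
        rw [← inner_conj_symm, map_eq_zero_iff _ (starRingEnd ℂ).injective, L2.inner_def] at h1
        rw [← h1]
        refine integral_congr_ae ?_
        filter_upwards [(hm (-l)).coeFn_toLp] with ν hν
        simp only [hv, hν, RCLike.inner_apply]
        push_cast
        simp only [neg_mul, neg_neg]
        ring
    rw [L2.inner_def]
    refine integral_eq_zero_of_ae ?_
    filter_upwards [hH.coeFn_toLp, hzero, (ae_restrict_iff' hB0).1 hne] with ν h1 h2 h3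
    simp only [RCLike.inner_apply, h1, Pi.zero_apply] at h2 ⊢
    by_cases hc : ν ∈ Set.Icc (-B) B
    · rw [(mul_eq_zero.1 h2).resolve_right (h3 hc), mul_zero]
    · rw [hH0 ν hc, zero_mul]
  have hmem' : hH.toLp H ∈ closure (K : Set (Lp ℂ 2 (volume : Measure ℝ))) := hmem
  obtain ⟨y, hyK, hy⟩ := Metric.mem_closure_iff.1 hmem' (Real.sqrt ε) (Real.sqrt_pos.2 hε)
  obtain ⟨p, rfl⟩ := Finsupp.mem_span_range_iff_exists_finsupp.1 hyK
  refine ⟨p, ?_⟩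
  rw [dist_comm, dist_eq_norm] at hy
  have h2 : ‖(p.sum fun l c => c • v l) - hH.toLp H‖ ^ 2
      = ∫ ν, ‖transfer Te p ν * G ν - H ν‖ ^ 2 := by
    rw [norm_sq_eq_integral]
    refine integral_congr_ae ?_
    have hall : ∀ᵐ ν ∂(volume : Measure ℝ), ∀ l : ℤ, v l ν = osc (-(l * Te * ν)) * G ν :=
      ae_all_iff.2 fun l => (hm l).coeFn_toLp
    have hsum : ∀ s : Finset ℤ, ∀ᵐ ν ∂(volume : Measure ℝ),
        (∑ l ∈ s, p l • v l : Lp ℂ 2 (volume : Measure ℝ)) ν = ∑ l ∈ s, p l * v l ν := by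
      intro s
      induction s using Finset.induction_on with
      | empty =>
        filter_upwards [Lp.coeFn_zero ℂ 2 (volume : Measure ℝ)] with ν _
        simp
      | insert l s hl ih =>
        rw [Finset.sum_insert hl]
        filter_upwards [ih, Lp.coeFn_add (p l • v l) (∑ l ∈ s, p l • v l),
          Lp.coeFn_smul (p l) (v l)] with ν h1 h2 h3
        rw [h2, Pi.add_apply, h1, h3, Finset.sum_insert hl]
        simp
    filter_upwards [Lp.coeFn_sub (p.sum fun l c => c • v l) (hH.toLp H), hH.coeFn_toLp, hall,
      hsum p.support] with ν h1 h2 h3 h4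
    have h5 : (p.sum fun l c => c • v l : Lp ℂ 2 (volume : Measure ℝ)) ν
        = transfer Te p ν * G ν := by
      rw [Finsupp.sum, h4, transfer, Finsupp.sum, Finset.sum_mul]
      exact Finset.sum_congr rfl fun l _ => by rw [h3 l, ← mul_assoc]
    rw [h1, Pi.sub_apply, h2, h5]
  rw [← h2, ← Real.sq_sqrt hε.le]
  exact pow_lt_pow_left₀ hy (norm_nonneg _) two_ne_zero

/-! ### Orthonormal series -/

section orthonormal

variable {ι E : Type*} [NormedAddCommGroup E] [InnerProductSpace ℂ E] {b : ι → E} {c d : ι → ℂ}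

theorem summable_smul_of_orthonormal [CompleteSpace E] (hb : Orthonormal ℂ b)
    (hc : Summable fun i => ‖c i‖ ^ 2) : Summable fun i => c i • b i := by
  have := (hb.orthogonalFamily.summable_iff_norm_sq_summable c).2 hc
  simpa using this

theorem inner_hasSum_of_orthonormal (hb : Orthonormal ℂ b) {x y : E}
    (hx : HasSum (fun i => c i • b i) x) (hy : HasSum (fun i => d i • b i) y) :
    HasSum (fun i => conj (c i) * d i) (inner ℂ x y) := by
  classical
  have h1 : ∀ i, inner ℂ (b i) x = c i := by
    intro i
    have h2 := hx.mapL (innerSL ℂ (b i))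
    simp only [innerSL_apply_apply, inner_smul_right, orthonormal_iff_ite.1 hb] at h2
    refine h2.unique ?_
    convert! hasSum_ite_eq i (c i) using 2 with j
    by_cases hij : i = j
    · subst hij; simp
    · simp [hij, Ne.symm hij]
  have h3 := hy.mapL (innerSL ℂ x)
  simp only [innerSL_apply_apply, inner_smul_right] at h3
  convert! h3 using 2 with i
  rw [← inner_conj_symm, h1, mul_comm]

theorem norm_sq_hasSum_of_orthonormal (hb : Orthonormal ℂ b) {x : E}
    (hx : HasSum (fun i => c i • b i) x) : HasSum (fun i => ‖c i‖ ^ 2) (‖x‖ ^ 2) := by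
  have := inner_hasSum_of_orthonormal hb hx hx
  simp only [Complex.conj_mul', inner_self_eq_norm_sq_to_K] at this
  refine Complex.hasSum_ofReal.1 ?_
  push_cast
  exact this

end orthonormal

/-! ### The signals that are modulated by band-limited functions -/

section signals

variable {Ω : Type*} [MeasurableSpace Ω] {μ : Measure Ω} {b : ℤ → Lp ℂ 2 μ}
  {W T Te : ℝ} {G f G' f' : ℝ → ℂ}

theorem IsSpectrum.hasSum_linearModulation (h : IsSpectrum W G f) (hT : 0 < T)
    (hb : Orthonormal ℂ b) (t : ℝ) :
    HasSum (fun m : ℤ => f (t - m * T) • b m) (linearModulation T f b t) :=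
  (summable_smul_of_orthonormal hb (h.summable_norm_sq hT t)).hasSum

theorem IsSpectrum.norm_sq_linearModulation (h : IsSpectrum W G f) (hT : 0 < T)
    (hb : Orthonormal ℂ b) (t : ℝ) :
    ‖linearModulation T f b t‖ ^ 2 = ∑' m : ℤ, ‖f (t - m * T)‖ ^ 2 :=
  (norm_sq_hasSum_of_orthonormal hb (h.hasSum_linearModulation hT hb t)).tsum_eq.symm

theorem IsSpectrum.sampledSignal_sub (h : IsSpectrum W G f) (h' : IsSpectrum W G' f') (hT : 0 < T)
    (hb : Orthonormal ℂ b) (n : ℤ) :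
    sampledSignal T Te f b n - sampledSignal T Te f' b n
      = sampledSignal T Te (fun t => f t - f' t) b n := by
  have h1 := (h.hasSum_linearModulation hT hb (n * Te)).sub
    (h'.hasSum_linearModulation hT hb (n * Te))
  simp only [← sub_smul] at h1
  exact h1.unique ((h.sub h').hasSum_linearModulation hT hb (n * Te))

theorem IsSpectrum.fir (h : IsSpectrum W G f) (Te : ℝ) (p : ℤ →₀ ℂ) :
    IsSpectrum W (fun ν => transfer Te p ν * G ν)
      (fun t => p.sum fun l c => c * f (t - l * Te)) := by
  have := IsSpectrum.finsetSum (s := p.support) fun l _ =>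
    (h.translate (l * Te)).const_mul (p l)
  convert! this using 2 with ν
  rw [transfer, Finsupp.sum, Finset.sum_mul]
  exact Finset.sum_congr rfl fun l _ => by ring

theorem IsSpectrum.firOutput_sampledSignal (h : IsSpectrum W G f) (hT : 0 < T)
    (hb : Orthonormal ℂ b) (p : ℤ →₀ ℂ) (n : ℤ) :
    firOutput p (sampledSignal T Te f b) n
      = sampledSignal T Te (fun t => p.sum fun l c => c * f (t - l * Te)) b n := by
  have h1 : HasSum (fun m : ℤ => ∑ l ∈ p.support, p l • f (((n - l : ℤ) : ℝ) * Te - m * T) • b m)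
      (firOutput p (sampledSignal T Te f b) n) :=
    hasSum_sum fun l _ => (h.hasSum_linearModulation hT hb _).const_smul (p l)
  refine h1.unique ?_
  convert! (h.fir Te p).hasSum_linearModulation hT hb (n * Te) using 2 with m
  rw [Finsupp.sum, Finset.sum_smul]
  refine Finset.sum_congr rfl fun l _ => ?_
  rw [smul_smul]
  congr 3
  push_cast; ring

theorem IsSpectrum.norm_sq_sampledSignal_le (h : IsSpectrum W G f) (hT : 0 < T) (hW : W ≤ 1 / T)
    (hb : Orthonormal ℂ b) (n : ℤ) :
    ‖sampledSignal T Te f b n‖ ^ 2 ≤ 2 / T * ∫ ν, ‖G ν‖ ^ 2 := by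
  rw [sampledSignal, h.norm_sq_linearModulation hT hb]
  simpa using h.tsum_norm_sq_le (L := 1) hT (by simpa using hW) (n * Te)

theorem IsSpectrum.hasTimeMean_norm_sq_sampledSignal (h : IsSpectrum W G f) (hT : 0 < T)
    (hW : W ≤ 1 / T) (hb : Orthonormal ℂ b) (hα : NonResonant (Te / T) 3) :
    HasTimeMean (fun n => ‖sampledSignal T Te f b n‖ ^ 2) (1 / T * ∫ t, ‖f t‖ ^ 2) := by
  have h1 := (h.hasTimeMean_norm_sq (L := 1) hT (by simpa using hW) 0 (J := 3) (by simp) hα).map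
    Complex.reCLM
  simp only [Int.cast_zero, zero_mul, zero_div, neg_zero, osc_zero, mul_one,
    integral_complex_ofReal, ← Complex.ofReal_mul, Complex.reCLM_apply, Complex.ofReal_re] at h1
  simp only [sampledSignal, h.norm_sq_linearModulation hT hb]
  exact h1

/-- A time average is at most a uniform bound. This is the converse of `norm_sq_sampledSignal_le`
and makes the spectra of uniformly convergent outputs Cauchy in `L²`. -/
theorem IsSpectrum.integral_norm_sq_le (h : IsSpectrum W G f) (hT : 0 < T)
    (hW : W ≤ 1 / T) (hb : Orthonormal ℂ b) (hα : NonResonant (Te / T) 3) {C : ℝ}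
    (hC : ∀ n, ‖sampledSignal T Te f b n‖ ^ 2 ≤ C) : ∫ ν, ‖G ν‖ ^ 2 ≤ T * C := by
  have h1 := (h.hasTimeMean_norm_sq_sampledSignal hT hW hb hα).le_of_forall_le hC
  rwa [one_div, inv_mul_le_iff₀ hT, h.integral_norm_sq_time] at h1

/-- The filtered versions of a sampled signal whose spectrum fills the band are the signals that
are modulated by the band-limited functions. -/
theorem isFiltered_sampledSignal_iff (hT : 0 < T) (hTe : 0 < Te) (hW : W ≤ 1 / T)
    (hWTe : 2 * W * Te < 1) (hb : Orthonormal ℂ b) (hα : NonResonant (Te / T) 3)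
    (hG : IsSpectrum W G f) (hne : ∀ᵐ ν ∂(volume.restrict (Set.Icc (-W) W)), G ν ≠ 0)
    (r : ℤ → Lp ℂ 2 μ) :
    IsFiltered (sampledSignal T Te f b) r ↔ ∃ u ∈ bandLimited W, r = sampledSignal T Te u b := by
  constructor
  · rintro ⟨p, hp⟩
    set Γ : ℕ → ℝ → ℂ := fun k ν => transfer Te (p k) ν * G ν with hΓ
    set φ : ℕ → ℝ → ℂ := fun k t => (p k).sum fun l c => c * f (t - l * Te) with hφ
    have hs : ∀ k, IsSpectrum W (Γ k) (φ k) := fun k => hG.fir Te (p k)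
    have hout : ∀ k n, firOutput (p k) (sampledSignal T Te f b) n = sampledSignal T Te (φ k) b n :=
      fun k n => hG.firOutput_sampledSignal hT hb (p k) n
    have hcauchy : CauchySeq fun k => (hs k).1.toLp (Γ k) := by
      refine Metric.cauchySeq_iff.2 fun ε hε => ?_
      -- Chosen so that `T (2 δ)² = ε² / 4`.
      set δ : ℝ := ε / (4 * Real.sqrt T) with hδ
      have hsT : 0 < Real.sqrt T := Real.sqrt_pos.2 hT
      have hδ0 : 0 < δ := by positivity
      obtain ⟨N, hN⟩ := eventually_atTop.1 (Metric.tendstoUniformly_iff.1 hp δ hδ0)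
      refine ⟨N, fun k hk j hj => ?_⟩
      have hle : ∫ ν, ‖Γ k ν - Γ j ν‖ ^ 2 ≤ T * (2 * δ) ^ 2 := by
        refine ((hs k).sub (hs j)).integral_norm_sq_le hT hW hb hα fun n => ?_
        rw [← (hs k).sampledSignal_sub (hs j) hT hb, ← hout, ← hout]
        have h1 := hN k hk n
        have h2 := hN j hj n
        refine pow_le_pow_left₀ (norm_nonneg _) ?_ 2
        rw [← dist_eq_norm]
        refine (dist_triangle_left _ _ (r n)).trans ?_
        linarith
      rw [dist_eq_norm]
      refine lt_of_pow_lt_pow_left₀ 2 hε.le ?_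
      rw [norm_sq_toLp_sub]
      refine hle.trans_lt ?_
      have : T * (2 * δ) ^ 2 = ε ^ 2 / 4 := by
        rw [hδ]
        field_simp
        rw [Real.sq_sqrt hT.le]; ring
      rw [this]
      have := pow_pos hε 2
      linarith
    obtain ⟨y, hy⟩ := cauchySeq_tendsto_of_complete hcauchy
    -- The limit is only a class in `L²`; cutting it off gives a representative supported in the
    -- band and does not increase the distance to the `Γ k`, which vanish outside.
    have hH := IsSpectrum.of_memLp W (Lp.memLp y)
    set H : ℝ → ℂ := (Set.Icc (-W) W).indicator y with hHdef
    refine ⟨𝓕⁻ H, hH.mem_bandLimited, funext fun n => ?_⟩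
    have hlim : Tendsto (fun k => sampledSignal T Te (φ k) b n) atTop (𝓝 (r n)) := by
      have := hp.tendsto_at n
      simpa only [hout] using this
    refine tendsto_nhds_unique hlim ?_
    rw [tendsto_iff_norm_sub_tendsto_zero]
    have hdist : Tendsto (fun k => Real.sqrt (2 / T) * ‖(hs k).1.toLp (Γ k) - y‖) atTop (𝓝 0) := by
      simpa using (tendsto_iff_norm_sub_tendsto_zero.1 hy).const_mul (Real.sqrt (2 / T))
    refine squeeze_zero (fun k => norm_nonneg _) (fun k => ?_) hdist
    refine le_of_sq_le_sq ?_ (by positivity)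
    rw [mul_pow, Real.sq_sqrt (by positivity), (hs k).sampledSignal_sub hH hT hb]
    refine (((hs k).sub hH).norm_sq_sampledSignal_le hT hW hb n).trans ?_
    refine mul_le_mul_of_nonneg_left ?_ (by positivity)
    have hy' := norm_sq_toLp_sub (hs k).1 (Lp.memLp y)
    rw [Lp.toLp_coeFn] at hy'
    rw [hy']
    refine integral_mono ((hs k).sub hH).integrable_norm_sq
      (((hs k).1.sub (Lp.memLp y)).integrable_norm_pow (by norm_num)) fun ν => ?_
    by_cases hν : ν ∈ Set.Icc (-W) W
    · simp [hHdef, hν]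
    · simp only [hHdef, Set.indicator_of_notMem hν, (hs k).2.1 ν hν]
      simp
  · rintro ⟨u, ⟨-, H, hH⟩, rfl⟩
    have hex : ∀ k : ℕ, ∃ p : ℤ →₀ ℂ,
        ∫ ν, ‖transfer Te p ν * G ν - H ν‖ ^ 2 < 1 / ((k : ℝ) + 1) := fun k =>
      exists_transfer_approx hTe hWTe hG.1 hG.2.1 hne hH.1 hH.2.1 (by positivity)
    choose p hp using hex
    refine ⟨p, Metric.tendstoUniformly_iff.2 fun ε hε => ?_⟩
    have hlim : Tendsto (fun k : ℕ => 2 / T * (1 / ((k : ℝ) + 1))) atTop (𝓝 0) := by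
      simpa using tendsto_one_div_add_atTop_nhds_zero_nat.const_mul (2 / T)
    filter_upwards [hlim.eventually_lt_const (pow_pos hε 2)] with k hk n
    rw [dist_comm, dist_eq_norm, hG.firOutput_sampledSignal hT hb,
      (hG.fir Te (p k)).sampledSignal_sub hH hT hb]
    refine lt_of_pow_lt_pow_left₀ 2 hε.le ?_
    refine (((hG.fir Te (p k)).sub hH).norm_sq_sampledSignal_le hT hW hb n).trans_lt ?_
    refine lt_of_le_of_lt ?_ hk
    exact mul_le_mul_of_nonneg_left (hp k).le (by positivity)

end signals

/-! ### Moments of series of BPSK symbols -/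

namespace IsBPSK

variable {Ω : Type*} [MeasurableSpace Ω] {μ : Measure Ω} {a : ℤ → Ω → ℂ}

theorem integral_symbol [IsProbabilityMeasure μ] (ha : IsBPSK a μ) (m : ℤ) :
    ∫ ω, a m ω ∂μ = 0 := by
  have hs : MeasurableSet {ω | a m ω = 1} := ha.measurable m (measurableSet_singleton 1)
  have h1 : ∀ᵐ ω ∂μ, a m ω = 2 * ({ω | a m ω = 1}.indicator (fun _ => (1 : ℂ)) ω) - 1 := by
    filter_upwards [ha.values m] with ω hω
    rcases hω with h | h
    · have : ω ∈ {ω | a m ω = 1} := h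
      rw [Set.indicator_of_mem this, h]; norm_num
    · have : ω ∉ {ω | a m ω = 1} := by
        simp only [Set.mem_ofPred_eq, h]; norm_num
      rw [Set.indicator_of_notMem this, h]; norm_num
  rw [integral_congr_ae h1, integral_sub _ (integrable_const _), integral_const_mul,
    integral_indicator_const _ hs, Measure.real, ha.prob_one m]
  · simp
  · exact ((integrable_const (1 : ℂ)).indicator hs).const_mul 2

theorem norm_symbol (ha : IsBPSK a μ) (m : ℤ) : ∀ᵐ ω ∂μ, ‖a m ω‖ = 1 := by
  filter_upwards [ha.values m] with ω hω
  rcases hω with h | h <;> simp [h]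

/-- A finite combination of the symbols. -/
def partialSum {Ω : Type*} (a : ℤ → Ω → ℂ) (c : ℤ → ℂ) (s : Finset ℤ) (ω : Ω) : ℂ :=
  ∑ m ∈ s, c m * a m ω

theorem measurable_partialSum (ha : IsBPSK a μ) (c : ℤ → ℂ) (s : Finset ℤ) :
    Measurable (partialSum a c s) :=
  Finset.measurable_sum s fun m _ => (ha.measurable m).const_mul (c m)

theorem norm_partialSum_le (ha : IsBPSK a μ) (c : ℤ → ℂ) (s : Finset ℤ) :
    ∀ᵐ ω ∂μ, ‖partialSum a c s ω‖ ≤ ∑ m ∈ s, ‖c m‖ := by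
  filter_upwards [ae_all_iff.2 ha.norm_symbol] with ω hω
  refine (norm_sum_le _ _).trans_eq (Finset.sum_congr rfl fun m _ => ?_)
  rw [norm_mul, hω, mul_one]

theorem integrable_comp_partialSum [IsProbabilityMeasure μ] (ha : IsBPSK a μ)
    (c : ℤ → ℂ) (s : Finset ℤ)
    {E : Type*} [NormedAddCommGroup E] [SecondCountableTopology E] [MeasurableSpace E]
    [BorelSpace E] {φ : ℂ → E} (hφ : Continuous φ) :
    Integrable (fun ω => φ (partialSum a c s ω)) μ := by
  obtain ⟨C, hC⟩ := (isCompact_closedBall (0 : ℂ) (∑ m ∈ s, ‖c m‖)).exists_bound_of_continuousOn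
    hφ.continuousOn
  refine Integrable.of_bound
    (hφ.measurable.comp (ha.measurable_partialSum c s)).aestronglyMeasurable C ?_
  filter_upwards [ha.norm_partialSum_le c s] with ω hω
  exact hC _ (by simpa using hω)

theorem integrable_comp_partialSum_mul [IsProbabilityMeasure μ] (ha : IsBPSK a μ)
    (c : ℤ → ℂ) (s : Finset ℤ)
    {φ : ℂ → ℂ} (hφ : Continuous φ) (m : ℤ) :
    Integrable (fun ω => φ (partialSum a c s ω) * a m ω) μ := by
  refine (ha.integrable_comp_partialSum c s hφ).mul_bdd (c := 1)
    (ha.measurable m).aestronglyMeasurable ?_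
  filter_upwards [ha.norm_symbol m] with ω hω using hω.le

theorem integral_comp_partialSum_mul [IsProbabilityMeasure μ] (ha : IsBPSK a μ)
    (c : ℤ → ℂ) {s : Finset ℤ}
    {φ : ℂ → ℂ} (hφ : Continuous φ) {m : ℤ} (hm : m ∉ s) :
    ∫ ω, φ (partialSum a c s ω) * a m ω ∂μ = 0 := by
  -- Independence is applied to the variables `d j * a j`, so that their plain sum is `partialSum`;
  -- the value `d m = 1` leaves the new symbol itself, even if `c m = 0`.
  by_cases h0 : ∃ d : ℤ → ℂ, (∀ j ∈ s, d j = c j) ∧ d m = 1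
  · obtain ⟨d, hd, hdm⟩ := h0
    have hind : iIndepFun (fun j ω => d j * a j ω) μ :=
      ha.indep.comp (fun j z => d j * z) fun j => measurable_const_mul (d j)
    have hI := hind.indepFun_finsetSum_of_notMem
      (fun j => (ha.measurable j).const_mul (d j)) hm
    have hS : (∑ j ∈ s, fun ω => d j * a j ω) = partialSum a c s := by
      ext ω
      rw [Finset.sum_apply, partialSum]
      exact Finset.sum_congr rfl fun j hj => by rw [hd j hj]
    rw [hS] at hI
    simp only [hdm, one_mul] at hI
    have := hI.integral_fun_comp_mul_comp (f := φ) (g := fun z => z)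
      (ha.measurable_partialSum c s).aemeasurable (ha.measurable m).aemeasurable
      hφ.aestronglyMeasurable continuous_id.aestronglyMeasurable
    rw [this, ha.integral_symbol, mul_zero]
  · exact absurd ⟨fun j => if j = m then 1 else c j,
      fun j hj => if_neg (ne_of_mem_of_not_mem hj hm), if_pos rfl⟩ h0

theorem partialSum_insert {Ω : Type*} (a : ℤ → Ω → ℂ) (c : ℤ → ℂ) {s : Finset ℤ} {m : ℤ} (hm : m ∉ s)
    (ω : Ω) :
    partialSum a c (insert m s) ω = partialSum a c s ω + c m * a m ω := by
  rw [partialSum, Finset.sum_insert hm, add_comm]; rfl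

theorem integral_partialSum_sq [IsProbabilityMeasure μ] (ha : IsBPSK a μ)
    (c : ℤ → ℂ) (s : Finset ℤ) :
    ∫ ω, partialSum a c s ω ^ 2 ∂μ = ∑ m ∈ s, c m ^ 2 := by
  induction s using Finset.induction_on with
  | empty => simp [partialSum]
  | insert m s hm ih =>
    have h1 : ∀ᵐ ω ∂μ, partialSum a c (insert m s) ω ^ 2
        = (partialSum a c s ω ^ 2 + c m ^ 2) + 2 * c m * partialSum a c s ω * a m ω := by
      filter_upwards [ha.values m] with ω hω
      rw [partialSum_insert a c hm]
      rcases hω with h | h <;> rw [h] <;> ring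
    have i1 : Integrable (fun ω => partialSum a c s ω ^ 2) μ :=
      ha.integrable_comp_partialSum c s (φ := fun z => z ^ 2) (by fun_prop)
    have i12 : Integrable (fun ω => partialSum a c s ω ^ 2 + c m ^ 2) μ :=
      i1.add (integrable_const _)
    rw [integral_congr_ae h1, integral_add i12
      (ha.integrable_comp_partialSum_mul c s (φ := fun z => 2 * c m * z) (by fun_prop) m),
      integral_add i1 (integrable_const _),
      ha.integral_comp_partialSum_mul c (φ := fun z => 2 * c m * z) (by fun_prop) hm, ih,
      Finset.sum_insert hm]
    simp [add_comm]

theorem integral_norm_partialSum_sq [IsProbabilityMeasure μ] (ha : IsBPSK a μ)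
    (c : ℤ → ℂ) (s : Finset ℤ) :
    ∫ ω, ‖partialSum a c s ω‖ ^ 2 ∂μ = ∑ m ∈ s, ‖c m‖ ^ 2 := by
  induction s using Finset.induction_on with
  | empty => simp [partialSum]
  | insert m s hm ih =>
    have h1 : ∀ᵐ ω ∂μ, ‖partialSum a c (insert m s) ω‖ ^ 2
        = (‖partialSum a c s ω‖ ^ 2 + ‖c m‖ ^ 2)
          + RCLike.re (2 * conj (c m) * partialSum a c s ω * a m ω) := by
      filter_upwards [ha.values m] with ω hω
      rw [partialSum_insert a c hm]
      simp only [← Complex.normSq_eq_norm_sq, Complex.normSq_apply, RCLike.re_to_complex]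
      rcases hω with h | h <;> rw [h] <;> simp <;> ring
    have i1 : Integrable (fun ω => ‖partialSum a c s ω‖ ^ 2) μ :=
      ha.integrable_comp_partialSum c s (φ := fun z => ‖z‖ ^ 2) (by fun_prop)
    have i2 := ha.integrable_comp_partialSum_mul c s (φ := fun z => 2 * conj (c m) * z)
      (by fun_prop) m
    have i12 : Integrable (fun ω => ‖partialSum a c s ω‖ ^ 2 + ‖c m‖ ^ 2) μ :=
      i1.add (integrable_const _)
    rw [integral_congr_ae h1, integral_add i12 i2.re,
      integral_add i1 (integrable_const _), integral_re i2,
      ha.integral_comp_partialSum_mul c (φ := fun z => 2 * conj (c m) * z) (by fun_prop) hm, ih,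
      Finset.sum_insert hm]
    simp [add_comm]

/-- Induction on the number of symbols. As `a m = ± 1`, the expansion has a part free of `a m` and a
part linear in it, and the latter has mean zero by independence. -/
theorem integral_norm_partialSum_pow_four [IsProbabilityMeasure μ] (ha : IsBPSK a μ)
    (c : ℤ → ℂ) (s : Finset ℤ) :
    ∫ ω, ‖partialSum a c s ω‖ ^ 4 ∂μ
      = 2 * (∑ m ∈ s, ‖c m‖ ^ 2) ^ 2 + ‖∑ m ∈ s, c m ^ 2‖ ^ 2 - 2 * ∑ m ∈ s, ‖c m‖ ^ 4 := by
  induction s using Finset.induction_on with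
  | empty => simp [partialSum]
  | insert m s hm ih =>
    -- The coefficient of the new symbol in the expansion, before the real part is taken.
    set φ : ℂ → ℂ := fun z => 4 * conj (c m) * z * ((‖z‖ ^ 2 + ‖c m‖ ^ 2 : ℝ) : ℂ) with hφ
    have hφc : Continuous φ := by fun_prop
    have h1 : ∀ᵐ ω ∂μ, ‖partialSum a c (insert m s) ω‖ ^ 4
        = (((‖partialSum a c s ω‖ ^ 4 + 4 * ‖c m‖ ^ 2 * ‖partialSum a c s ω‖ ^ 2) + ‖c m‖ ^ 4)
          + RCLike.re (2 * conj (c m) ^ 2 * partialSum a c s ω ^ 2))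
          + RCLike.re (φ (partialSum a c s ω) * a m ω) := by
      filter_upwards [ha.values m] with ω hω
      rw [partialSum_insert a c hm]
      have e4 : ∀ z : ℂ, ‖z‖ ^ 4 = (‖z‖ ^ 2) ^ 2 := fun z => by rw [← pow_mul]
      simp only [hφ, e4, ← Complex.normSq_eq_norm_sq, Complex.normSq_apply, RCLike.re_to_complex]
      rcases hω with h | h <;> rw [h] <;> simp [pow_two] <;> ring
    have i1 : Integrable (fun ω => ‖partialSum a c s ω‖ ^ 4) μ :=
      ha.integrable_comp_partialSum c s (φ := fun z => ‖z‖ ^ 4) (by fun_prop)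
    have i2 : Integrable (fun ω => 4 * ‖c m‖ ^ 2 * ‖partialSum a c s ω‖ ^ 2) μ :=
      ha.integrable_comp_partialSum c s (φ := fun z => 4 * ‖c m‖ ^ 2 * ‖z‖ ^ 2) (by fun_prop)
    have i3 : Integrable (fun ω => 2 * conj (c m) ^ 2 * partialSum a c s ω ^ 2) μ :=
      ha.integrable_comp_partialSum c s (φ := fun z => 2 * conj (c m) ^ 2 * z ^ 2) (by fun_prop)
    have i4 := ha.integrable_comp_partialSum_mul c s hφc m
    have j1 : Integrable (fun ω => ‖partialSum a c s ω‖ ^ 4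
        + 4 * ‖c m‖ ^ 2 * ‖partialSum a c s ω‖ ^ 2) μ := i1.add i2
    have j2 : Integrable (fun ω => (‖partialSum a c s ω‖ ^ 4
        + 4 * ‖c m‖ ^ 2 * ‖partialSum a c s ω‖ ^ 2) + ‖c m‖ ^ 4) μ := j1.add (integrable_const _)
    have j3 : Integrable (fun ω => ((‖partialSum a c s ω‖ ^ 4
        + 4 * ‖c m‖ ^ 2 * ‖partialSum a c s ω‖ ^ 2) + ‖c m‖ ^ 4)
        + RCLike.re (2 * conj (c m) ^ 2 * partialSum a c s ω ^ 2)) μ := j2.add i3.re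
    rw [integral_congr_ae h1, integral_add j3 i4.re, integral_add j2 i3.re,
      integral_add j1 (integrable_const _), integral_add i1 i2, integral_re i3,
      integral_re i4, ha.integral_comp_partialSum_mul c hφc hm, ih, integral_const_mul,
      integral_const_mul, ha.integral_norm_partialSum_sq, ha.integral_partialSum_sq,
      Finset.sum_insert hm, Finset.sum_insert hm, Finset.sum_insert hm]
    have e : ‖c m ^ 2 + ∑ j ∈ s, c j ^ 2‖ ^ 2 = ‖c m‖ ^ 4 + ‖∑ j ∈ s, c j ^ 2‖ ^ 2
        + RCLike.re (2 * conj (c m) ^ 2 * ∑ j ∈ s, c j ^ 2) := by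
      have e4 : ∀ z : ℂ, ‖z‖ ^ 4 = (‖z‖ ^ 2) ^ 2 := fun z => by rw [← pow_mul]
      simp only [e4, ← Complex.normSq_eq_norm_sq, Complex.normSq_apply, RCLike.re_to_complex]
      simp [pow_two]
      ring
    rw [e]
    simp only [map_zero, integral_const, probReal_univ, smul_eq_mul, one_mul]
    ring

theorem orthonormal_symbol [IsProbabilityMeasure μ] (ha : IsBPSK a μ) :
    Orthonormal ℂ ha.symbol := by
  rw [orthonormal_iff_ite]
  intro i j
  have h1 : inner ℂ (ha.symbol i) (ha.symbol j) = ∫ ω, a i ω * a j ω ∂μ := by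
    rw [L2.inner_def]
    refine integral_congr_ae ?_
    filter_upwards [(ha.memLp i).coeFn_toLp, (ha.memLp j).coeFn_toLp, ha.values i] with ω hi hj hv
    rw [symbol, symbol, hi, hj, RCLike.inner_apply, mul_comm]
    rcases hv with h | h <;> simp [h]
  rw [h1]
  split_ifs with hij
  · subst hij
    have : ∀ᵐ ω ∂μ, a i ω * a i ω = 1 := by
      filter_upwards [ha.values i] with ω hω
      rcases hω with h | h <;> simp [h]
    rw [integral_congr_ae this]; simp
  · have := (ha.indep.indepFun hij).integral_fun_comp_mul_comp (f := fun z => z) (g := fun z => z)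
      (ha.measurable i).aemeasurable (ha.measurable j).aemeasurable
      continuous_id.aestronglyMeasurable continuous_id.aestronglyMeasurable
    rw [this, ha.integral_symbol, zero_mul]

theorem coeFn_sum_smul_toLp {p : ENNReal} (h : ∀ m, MemLp (a m) p μ) (c : ℤ → ℂ) (s : Finset ℤ) :
    (∑ m ∈ s, c m • (h m).toLp (a m) : Lp ℂ p μ) =ᵐ[μ] partialSum a c s := by
  induction s using Finset.induction_on with
  | empty =>
    rw [Finset.sum_empty]
    filter_upwards [Lp.coeFn_zero ℂ p μ] with ω hω
    rw [hω]; simp [partialSum]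
  | insert m s hm ih =>
    rw [Finset.sum_insert hm]
    filter_upwards [ih, Lp.coeFn_add (c m • (h m).toLp (a m)) (∑ m ∈ s, c m • (h m).toLp (a m)),
      Lp.coeFn_smul (c m) ((h m).toLp (a m)), (h m).coeFn_toLp] with ω h1 h2 h3 h4
    rw [h2, Pi.add_apply, h1, h3, Pi.smul_apply, h4, partialSum_insert a c hm, smul_eq_mul,
      add_comm]

theorem integral_sq_of_hasSum [IsProbabilityMeasure μ] (ha : IsBPSK a μ)
    {c : ℤ → ℂ} {x : Lp ℂ 2 μ}
    (hx : HasSum (fun m => c m • ha.symbol m) x) : ∫ ω, x ω ^ 2 ∂μ = ∑' m, c m ^ 2 := by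
  -- Pointwise conjugation on `L²`. The symbols are real, so it conjugates the coefficients, and the
  -- mean of `x²` is the inner product of `A x` and `x`.
  set A := ContinuousLinearMap.compLpL 2 μ (Complex.conjCLE : ℂ →L[ℝ] ℂ) with hA
  have hAb : ∀ m, A (c m • ha.symbol m) = conj (c m) • ha.symbol m := by
    intro m
    refine Lp.ext ?_
    filter_upwards [ContinuousLinearMap.coeFn_compLpL (Complex.conjCLE : ℂ →L[ℝ] ℂ)
      (c m • ha.symbol m), Lp.coeFn_smul (c m) (ha.symbol m),
      Lp.coeFn_smul (conj (c m)) (ha.symbol m), (ha.memLp m).coeFn_toLp, ha.values m]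
      with ω h1 h2 h3 h4 h5
    rw [hA, h1, h2, h3, Pi.smul_apply, Pi.smul_apply, symbol, h4]
    rcases h5 with h | h <;> simp [h]
  have h1 : HasSum (fun m => conj (c m) • ha.symbol m) (A x) := by
    simpa only [hAb] using hx.mapL A
  have h2 := inner_hasSum_of_orthonormal ha.orthonormal_symbol h1 hx
  simp only [Complex.conj_conj, ← pow_two] at h2
  rw [h2.tsum_eq, L2.inner_def]
  refine integral_congr_ae ?_
  filter_upwards [ContinuousLinearMap.coeFn_compLpL (Complex.conjCLE : ℂ →L[ℝ] ℂ) x] with ω h3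
  rw [hA, h3]
  simp [pow_two]

theorem norm_pow_four_eq_integral (x : Lp ℂ 4 μ) : ‖x‖ ^ 4 = ∫ ω, ‖x ω‖ ^ 4 ∂μ := by
  rw [Lp.norm_def, (Lp.memLp x).eLpNorm_eq_integral_rpow_norm (by norm_num) (by norm_num)]
  simp only [ENNReal.toReal_ofNat, Real.rpow_ofNat]
  have h0 : 0 ≤ ∫ ω, ‖x ω‖ ^ 4 ∂μ := integral_nonneg fun ω => by positivity
  rw [ENNReal.toReal_ofReal (Real.rpow_nonneg h0 _), ← Real.rpow_natCast, ← Real.rpow_mul h0]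
  norm_num

/-- The fourth moment of a finite sum is at most three times the square of its second moment, so the
series converges in `L⁴` too. Both limits are limits in measure and therefore coincide, and the
finite formula passes to the limit. -/
theorem integral_norm_pow_four_of_hasSum [IsProbabilityMeasure μ] (ha : IsBPSK a μ)
    {c : ℤ → ℂ} {x : Lp ℂ 2 μ}
    (hx : HasSum (fun m => c m • ha.symbol m) x) :
    ∫ ω, ‖x ω‖ ^ 4 ∂μ
      = 2 * (∑' m, ‖c m‖ ^ 2) ^ 2 + ‖∑' m, c m ^ 2‖ ^ 2 - 2 * ∑' m, ‖c m‖ ^ 4 := by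
  have : Fact ((1 : ENNReal) ≤ 4) := ⟨by norm_num⟩
  have hc := (norm_sq_hasSum_of_orthonormal ha.orthonormal_symbol hx).summable
  have h4 : ∀ m, MemLp (a m) 4 μ := fun m =>
    MemLp.of_bound (ha.measurable m).aestronglyMeasurable 1
      ((ha.norm_symbol m).mono fun ω hω => hω.le)
  set e : ℤ → Lp ℂ 4 μ := fun m => (h4 m).toLp (a m) with he
  have hnorm : ∀ s : Finset ℤ, ‖∑ m ∈ s, c m • e m‖ ^ 4
      = 2 * (∑ m ∈ s, ‖c m‖ ^ 2) ^ 2 + ‖∑ m ∈ s, c m ^ 2‖ ^ 2 - 2 * ∑ m ∈ s, ‖c m‖ ^ 4 := by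
    intro s
    rw [norm_pow_four_eq_integral, ← ha.integral_norm_partialSum_pow_four]
    refine integral_congr_ae ?_
    filter_upwards [coeFn_sum_smul_toLp h4 c s] with ω hω
    rw [hω]
  have hsum : Summable fun m => c m • e m := by
    rw [summable_iff_vanishing_norm]
    intro ε hε
    -- With tails below `ε² / 2`, the fourth power of the norm is below `3 ε⁴ / 4`.
    obtain ⟨s, hs⟩ := summable_iff_vanishing_norm.1 hc (ε ^ 2 / 2) (by positivity)
    refine ⟨s, fun t ht => lt_of_pow_lt_pow_left₀ 4 hε.le ?_⟩
    have h1 := hs t ht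
    have h0 : 0 ≤ ∑ m ∈ t, ‖c m‖ ^ 2 := Finset.sum_nonneg fun m _ => by positivity
    rw [Real.norm_of_nonneg h0] at h1
    have h2 : ‖∑ m ∈ t, c m ^ 2‖ ≤ ∑ m ∈ t, ‖c m‖ ^ 2 :=
      (norm_sum_le _ _).trans_eq (by simp only [norm_pow])
    have h3 : 0 ≤ ∑ m ∈ t, ‖c m‖ ^ 4 := Finset.sum_nonneg fun m _ => by positivity
    have h5 := pow_le_pow_left₀ (norm_nonneg _) h2 2
    have h6 := pow_lt_pow_left₀ h1 h0 two_ne_zero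
    rw [hnorm]
    nlinarith
  obtain ⟨z, hz⟩ := hsum
  have hzx : z =ᵐ[μ] x := by
    have m1 := (tendstoInMeasure_of_tendsto_Lp hz).congr_left fun s => coeFn_sum_smul_toLp h4 c s
    have m2 := (tendstoInMeasure_of_tendsto_Lp hx).congr_left
      fun s => coeFn_sum_smul_toLp ha.memLp c s
    exact tendstoInMeasure_ae_unique m1 m2
  have hq : Summable fun m => c m ^ 2 := Summable.of_norm (by simpa only [norm_pow] using hc)
  have hf : Summable fun m => ‖c m‖ ^ 4 := by
    refine Summable.of_nonneg_of_le (fun m => by positivity) (fun m => ?_)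
      (hc.mul_left (∑' m, ‖c m‖ ^ 2))
    have h1 := hc.le_tsum m fun j _ => by positivity
    have h2 : ‖c m‖ ^ 4 = ‖c m‖ ^ 2 * ‖c m‖ ^ 2 := by rw [← pow_add]
    rw [h2]
    exact mul_le_mul_of_nonneg_right h1 (by positivity)
  have lim1 : Tendsto (fun s : Finset ℤ => ‖∑ m ∈ s, c m • e m‖ ^ 4) atTop (𝓝 (‖z‖ ^ 4)) :=
    (hz.norm).pow 4
  have lim2 : Tendsto (fun s : Finset ℤ => ‖∑ m ∈ s, c m • e m‖ ^ 4) atTop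
      (𝓝 (2 * (∑' m, ‖c m‖ ^ 2) ^ 2 + ‖∑' m, c m ^ 2‖ ^ 2 - 2 * ∑' m, ‖c m‖ ^ 4)) := by
    simp only [hnorm]
    exact (((hc.hasSum.pow 2).const_mul 2).add ((hq.hasSum.norm).pow 2)).sub
      (hf.hasSum.const_mul 2)
  rw [← tendsto_nhds_unique lim1 lim2, norm_pow_four_eq_integral]
  refine integral_congr_ae ?_
  filter_upwards [hzx] with ω hω
  rw [hω]

theorem cumulant4_of_hasSum [IsProbabilityMeasure μ] (ha : IsBPSK a μ)
    {c : ℤ → ℂ} {x : Lp ℂ 2 μ}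
    (hx : HasSum (fun m => c m • ha.symbol m) x) : cumulant4 x = kappa * ∑' m, ‖c m‖ ^ 4 := by
  rw [cumulant4, ha.integral_norm_pow_four_of_hasSum hx, ha.integral_sq_of_hasSum hx,
    ← norm_sq_eq_integral, (norm_sq_hasSum_of_orthonormal ha.orthonormal_symbol hx).tsum_eq, kappa]
  ring

end IsBPSK

/-! ### The statistics of the filtered signals -/

theorem exp_eq_osc {n α x : ℝ} (h : x = n * α) :
    Complex.exp (-2 * Real.pi * I * n * α) = osc (-x) := by
  rw [h, osc]; congr 1; push_cast; ring

theorem cyclicInt_eq (T : ℝ) (l : ℤ) (f : ℝ → ℂ) :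
    cyclicInt (l / T) f = ∫ t, ((‖f t‖ ^ 2 : ℝ) : ℂ) * osc (-(l * t / T)) := by
  refine integral_congr_ae (ae_of_all _ fun t => ?_)
  simp only
  rw [← exp_eq_osc (n := l / T) (α := t) (by ring)]

theorem ncCyclicInt_eq (T : ℝ) (l : ℤ) (f : ℝ → ℂ) :
    ncCyclicInt (l / T) f = ∫ t, f t ^ 2 * osc (-(l * t / T)) := by
  refine integral_congr_ae (ae_of_all _ fun t => ?_)
  simp only
  rw [← exp_eq_osc (n := l / T) (α := t) (by ring)]

theorem ncCyclicInt_zero (f : ℝ → ℂ) : ncCyclicInt 0 f = ∫ t, f t ^ 2 := by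
  simp [ncCyclicInt]

theorem norm_cyclicInt_neg (c : ℝ) (f : ℝ → ℂ) : ‖cyclicInt (-c) f‖ = ‖cyclicInt c f‖ := by
  have : cyclicInt (-c) f = conj (cyclicInt c f) := by
    rw [cyclicInt, cyclicInt, ← integral_conj]
    refine integral_congr_ae (ae_of_all _ fun t => ?_)
    simp only [map_mul, Complex.conj_ofReal, ← Complex.exp_conj]
    congr 2
    simp [Complex.conj_ofNat]
  rw [this, Complex.norm_conj]

section statistics

variable {Ω : Type*} [MeasurableSpace Ω] {μ : Measure Ω} [IsProbabilityMeasure μ]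
  {a : ℤ → Ω → ℂ} {W T Te : ℝ} {G f : ℝ → ℂ}

theorem IsSpectrum.cyclicCorr_sampledSignal (h : IsSpectrum W G f) (ha : IsBPSK a μ) (hT : 0 < T)
    (hW : W ≤ 1 / T) (hα : NonResonant (Te / T) 3) (l : ℤ) (hl : |l| ≤ 2) :
    cyclicCorr (sampledSignal T Te f ha.symbol) (l * (Te / T)) 0
      = (1 / T : ℝ) * cyclicInt (l / T) f := by
  rw [cyclicInt_eq]
  refine HasTimeMean.timeMean_eq ?_
  convert! h.hasTimeMean_norm_sq (L := 1) (J := 3) (Te := Te) hT (by simpa using hW) l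
    (by push_cast; linarith) hα using 1
  ext n
  rw [← h.norm_sq_linearModulation hT ha.orthonormal_symbol, norm_sq_eq_integral,
    ← integral_complex_ofReal, ← integral_mul_const]
  refine integral_congr_ae (ae_of_all _ fun ω => ?_)
  simp only [add_zero, Complex.mul_conj', sampledSignal, Complex.ofReal_pow]
  rw [← exp_eq_osc (n := n) (α := l * (Te / T)) (by ring)]
  push_cast; rfl

theorem IsSpectrum.ncCyclicCorr_sampledSignal (h : IsSpectrum W G f) (ha : IsBPSK a μ)
    (hT : 0 < T) (hW : W ≤ 1 / T) (hα : NonResonant (Te / T) 3) (l : ℤ) (hl : |l| ≤ 2) :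
    ncCyclicCorr (sampledSignal T Te f ha.symbol) (l * (Te / T)) 0
      = (1 / T : ℝ) * ncCyclicInt (l / T) f := by
  rw [ncCyclicInt_eq]
  refine HasTimeMean.timeMean_eq ?_
  convert! h.hasTimeMean_sq (Te := Te) hT hW l hl hα using 1
  ext n
  rw [← ha.integral_sq_of_hasSum (h.hasSum_linearModulation hT ha.orthonormal_symbol (n * Te)),
    ← integral_mul_const]
  refine integral_congr_ae (ae_of_all _ fun ω => ?_)
  simp only [add_zero, ← pow_two, sampledSignal]
  rw [← exp_eq_osc (n := n) (α := l * (Te / T)) (by ring)]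
  push_cast; rfl

theorem IsSpectrum.timeMean_cumulant4 (h : IsSpectrum W G f) (ha : IsBPSK a μ) (hT : 0 < T)
    (hW : W ≤ 1 / T) (hα : NonResonant (Te / T) 3) :
    timeMean (fun n => cumulant4 (sampledSignal T Te f ha.symbol n))
      = kappa * (1 / T * ∫ t, ‖f t‖ ^ 4) := by
  refine HasTimeMean.timeMean_eq ?_
  have := (h.hasTimeMean_norm_pow_four hT hW hα).map (kappa • ContinuousLinearMap.id ℝ ℝ)
  convert! this using 1
  ext n
  rw [sampledSignal, ha.cumulant4_of_hasSum (h.hasSum_linearModulation hT ha.orthonormal_symbol _)]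
  rfl

theorem IsSpectrum.meanPower_sampledSignal (h : IsSpectrum W G f) (ha : IsBPSK a μ) (hT : 0 < T)
    (hW : W ≤ 1 / T) (hα : NonResonant (Te / T) 3) :
    meanPower (sampledSignal T Te f ha.symbol) = 1 / T * ∫ t, ‖f t‖ ^ 2 := by
  refine HasTimeMean.timeMean_eq ?_
  simpa only [norm_sq_eq_integral] using
    h.hasTimeMean_norm_sq_sampledSignal hT hW ha.orthonormal_symbol hα

/-- Energy `T` means unit power, so the factors `1 / T²` are the denominators of `Phi`. The
correlations at `± α` have equal modulus, which turns the weight `2` into `4`. -/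
theorem IsSpectrum.beta_sampledSignal (h : IsSpectrum W G f) (ha : IsBPSK a μ) (hT : 0 < T)
    (hW : W ≤ 1 / T) (hα : NonResonant (Te / T) 3) (hf : ∫ t, ‖f t‖ ^ 2 = T) :
    beta (Te / T) (sampledSignal T Te f ha.symbol) = Phi T f := by
  have c1 := h.cyclicCorr_sampledSignal ha hT hW hα 1 (by simp)
  have c2 := h.cyclicCorr_sampledSignal ha hT hW hα (-1) (by simp)
  have n0 := h.ncCyclicCorr_sampledSignal ha hT hW hα 0 (by simp)
  have n1 := h.ncCyclicCorr_sampledSignal ha hT hW hα 1 (by simp)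
  have n2 := h.ncCyclicCorr_sampledSignal ha hT hW hα (-1) (by simp)
  simp only [Int.cast_one, one_mul, Int.cast_neg, neg_mul, neg_div, Int.cast_zero, zero_mul,
    zero_div] at c1 c2 n0 n1 n2
  have hT0 : T ≠ 0 := hT.ne'
  have hnorm : ∀ z : ℂ, ‖((1 / T : ℝ) : ℂ) * z‖ ^ 2 = ‖z‖ ^ 2 / T ^ 2 := fun z => by
    rw [norm_mul, mul_pow, Complex.norm_real, Real.norm_of_nonneg (by positivity)]
    ring
  have hdiv : ∀ z : ℂ, ‖z / (T : ℂ)‖ ^ 2 = ‖z‖ ^ 2 / T ^ 2 := fun z => by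
    rw [norm_div, div_pow, Complex.norm_real, Real.norm_of_nonneg hT.le]
  rw [beta, Phi, h.timeMean_cumulant4 ha hT hW hα, c1, c2, n0, n1, n2, hf, ncCyclicInt_zero]
  simp only [hnorm, hdiv, norm_cyclicInt_neg]
  field_simp
  ring

/-! ### The functional of the analog filter -/

theorem Phi_const_mul (T : ℝ) {c : ℝ} (hc : 0 < c) (f : ℝ → ℂ) :
    Phi T (fun t => (c : ℂ) * f t) = Phi T f := by
  have hc0 : c ≠ 0 := hc.ne'
  have hn : ∀ z : ℂ, ‖(c : ℂ) * z‖ = c * ‖z‖ := fun z => by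
    rw [norm_mul, Complex.norm_real, Real.norm_of_nonneg hc.le]
  have e1 : ∀ d, cyclicInt d (fun t => (c : ℂ) * f t) = (c : ℂ) ^ 2 * cyclicInt d f := fun d => by
    rw [cyclicInt, cyclicInt, ← integral_const_mul]
    refine integral_congr_ae (ae_of_all _ fun t => ?_)
    simp only [hn]; push_cast; ring
  have e2 : ∀ d, ncCyclicInt d (fun t => (c : ℂ) * f t) = (c : ℂ) ^ 2 * ncCyclicInt d f :=
    fun d => by
      rw [ncCyclicInt, ncCyclicInt, ← integral_const_mul]
      refine integral_congr_ae (ae_of_all _ fun t => ?_)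
      simp only; ring
  have hn2 : ∀ z : ℂ, ‖(c : ℂ) ^ 2 * z‖ = c ^ 2 * ‖z‖ := fun z => by
    rw [norm_mul, norm_pow, Complex.norm_real, Real.norm_of_nonneg hc.le]
  simp only [Phi, ← ncCyclicInt_zero, e1, e2, hn, hn2, mul_pow, integral_const_mul, norm_div,
    div_pow, Complex.norm_real, norm_mul, norm_pow, Real.norm_eq_abs, sq_abs]
  have h8 : c ^ 4 * (∫ t, ‖f t‖ ^ 4) / ((c ^ 2) ^ 2 * (∫ t, ‖f t‖ ^ 2) ^ 2)
      = (∫ t, ‖f t‖ ^ 4) / (∫ t, ‖f t‖ ^ 2) ^ 2 := by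
    rw [← pow_mul]; exact mul_div_mul_left _ _ (pow_ne_zero _ hc0)
  have h9 : ∀ x : ℝ, (c ^ 2) ^ 2 * x / ((c ^ 2) ^ 2 * (∫ t, ‖f t‖ ^ 2) ^ 2)
      = x / (∫ t, ‖f t‖ ^ 2) ^ 2 := fun x => mul_div_mul_left _ _ (by positivity)
  simp only [h8, h9]

theorem IsSpectrum.integral_norm_sq_pos (h : IsSpectrum W G f) (hf : f ≠ 0) :
    0 < ∫ t, ‖f t‖ ^ 2 := by
  have h0 : 0 ≤ ∫ t, ‖f t‖ ^ 2 := integral_nonneg fun t => by positivity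
  refine h0.lt_of_ne fun hz => hf ?_
  have h1 := (integral_eq_zero_iff_of_nonneg (fun t => by positivity)
    (h.memLp.integrable_norm_pow (by norm_num))).1 hz.symm
  refine (Continuous.ae_eq_iff_eq volume h.continuous continuous_zero).1 ?_
  filter_upwards [h1] with t ht
  simpa using ht

/-- Only the kurtosis term is negative. Since `‖f‖²` is at most `2 / T` times the energy, that term
is at least `-4`. -/
theorem IsSpectrum.neg_two_le_Phi (h : IsSpectrum W G f) (hT : 0 < T) (hW : W ≤ 1 / T)
    (hf : f ≠ 0) : -2 ≤ Phi T f := by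
  have hpos := h.integral_norm_sq_pos hf
  have hsq : ∀ t, ‖f t‖ ^ 2 ≤ 2 / T * ∫ t, ‖f t‖ ^ 2 := fun t => by
    have h1 := h.tsum_norm_sq_le (L := 1) hT (by simpa using hW) t
    have h2 := (h.summable_norm_sq hT t).le_tsum 0 fun j _ => by positivity
    simp only [Int.cast_zero, zero_mul, sub_zero] at h2
    rw [← h.integral_norm_sq_time] at h1
    refine h2.trans (h1.trans_eq ?_)
    simp
  have hi : Integrable fun t => ‖f t‖ ^ 2 := h.memLp.integrable_norm_pow (by norm_num)
  have h4 : ∫ t, ‖f t‖ ^ 4 ≤ 2 / T * (∫ t, ‖f t‖ ^ 2) * ∫ t, ‖f t‖ ^ 2 := by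
    rw [← integral_const_mul]
    refine integral_mono_of_nonneg (ae_of_all _ fun t => by positivity) (hi.const_mul _)
      (ae_of_all _ fun t => ?_)
    have : ‖f t‖ ^ 4 = ‖f t‖ ^ 2 * ‖f t‖ ^ 2 := by rw [← pow_add]
    simp only [this]
    exact mul_le_mul_of_nonneg_right (hsq t) (by positivity)
  have h5 : T * ((∫ t, ‖f t‖ ^ 4) / (∫ t, ‖f t‖ ^ 2) ^ 2) ≤ 2 := by
    rw [← mul_div_assoc, div_le_iff₀ (by positivity)]
    refine (mul_le_mul_of_nonneg_left h4 hT.le).trans_eq ?_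
    field_simp
  have p1 : 0 ≤ 4 * ‖cyclicInt (1 / T) f / ((∫ t : ℝ, ‖f t‖ ^ 2 : ℝ) : ℂ)‖ ^ 2 := by positivity
  have p2 : 0 ≤ ‖∫ t : ℝ, f t ^ 2‖ ^ 2 / (∫ t : ℝ, ‖f t‖ ^ 2) ^ 2 := by positivity
  have p3 : 0 ≤ ‖ncCyclicInt (1 / T) f‖ ^ 2 / (∫ t : ℝ, ‖f t‖ ^ 2) ^ 2 := by positivity
  have p4 : 0 ≤ ‖ncCyclicInt (-(1 / T)) f‖ ^ 2 / (∫ t : ℝ, ‖f t‖ ^ 2) ^ 2 := by positivity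
  rw [Phi, kappa]
  linarith

theorem bandLimited_mono {W W' : ℝ} (h : W ≤ W') : bandLimited W ⊆ bandLimited W' :=
  fun _ ⟨hf, G, hG⟩ => ⟨hf, G, hG.mono h⟩

/-- The values of `β` on the filtered signals of unit power are the values of `Φ`. -/
theorem image_beta_eq_image_Phi (ha : IsBPSK a μ) (hT : 0 < T) (hTe : 0 < Te) (hW : W ≤ 1 / T)
    (hWTe : 2 * W * Te < 1) (hα : NonResonant (Te / T) 3) (hG : IsSpectrum W G f)
    (hne : ∀ᵐ ν ∂(volume.restrict (Set.Icc (-W) W)), G ν ≠ 0) :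
    beta (Te / T) '' {r | IsFiltered (sampledSignal T Te f ha.symbol) r ∧ meanPower r = 1}
      = Phi T '' {u | u ∈ bandLimited W ∧ u ≠ 0} := by
  have hiff := isFiltered_sampledSignal_iff (Te := Te) hT hTe hW hWTe ha.orthonormal_symbol hα hG
    hne
  apply Set.Subset.antisymm
  · rintro _ ⟨r, ⟨hr, hp⟩, rfl⟩
    obtain ⟨u, hu, rfl⟩ := (hiff r).1 hr
    obtain ⟨-, H, hH⟩ := id hu
    rw [hH.meanPower_sampledSignal ha hT hW hα, one_div, inv_mul_eq_one₀ hT.ne'] at hp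
    refine ⟨u, ⟨hu, ?_⟩, (hH.beta_sampledSignal ha hT hW hα hp.symm).symm⟩
    rintro rfl
    simp at hp
    exact hT.ne' hp
  · rintro _ ⟨u, ⟨⟨-, H, hH⟩, hu0⟩, rfl⟩
    have hpos := hH.integral_norm_sq_pos hu0
    -- Scaling `u` by the square root of `T / E` gives unit power and leaves `Phi` unchanged.
    set E := ∫ t, ‖u t‖ ^ 2
    have hc : 0 < Real.sqrt (T / E) := Real.sqrt_pos.2 (by positivity)
    have hs := hH.const_mul (Real.sqrt (T / E) : ℂ)
    have hE : ∫ t, ‖(Real.sqrt (T / E) : ℂ) * u t‖ ^ 2 = T := by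
      simp only [norm_mul, mul_pow, Complex.norm_real, Real.norm_of_nonneg hc.le]
      rw [integral_const_mul, Real.sq_sqrt (by positivity)]
      exact div_mul_cancel₀ T hpos.ne'
    refine ⟨_, ⟨(hiff _).2 ⟨_, hs.mem_bandLimited, rfl⟩, ?_⟩, ?_⟩
    · rw [hs.meanPower_sampledSignal ha hT hW hα, hE, one_div_mul_cancel hT.ne']
    · rw [hs.beta_sampledSignal ha hT hW hα hE, Phi_const_mul T hc]

theorem isGLB_betaMin (ha : IsBPSK a μ) (hT : 0 < T) {γ : ℝ} (hγ : γ ∈ Set.Ico (0 : ℝ) 1)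
    (hTe : IsSamplingPeriod T γ Te) (hg : IsShapingFilter T γ f) :
    IsGLB (Phi T '' {u | u ∈ bandLimited (halfBand T γ) ∧ u ≠ 0}) (betaMin T Te f ha.symbol) := by
  obtain ⟨-, G, hG, hne⟩ := hg
  have hW : halfBand T γ ≤ 1 / T := by
    rw [halfBand, div_le_div_iff₀ (by positivity) hT]
    nlinarith [hγ.2]
  have hW0 : 0 < halfBand T γ := by
    have := hγ.1
    rw [halfBand]; positivity
  have hWTe : 2 * halfBand T γ * Te < 1 := by
    have : 2 * halfBand T γ * Te = Te * (1 + γ) / T := by rw [halfBand]; field_simp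
    rw [this, div_lt_one hT]
    exact hTe.shannon
  rw [betaMin, image_beta_eq_image_Phi ha hT hTe.pos hW hWTe (hTe.nonResonant hT hγ.1) hG hne]
  -- The real `sInf` is a genuine infimum only for a nonempty set bounded below. The shaping filter
  -- itself is a nonzero element, as its spectrum does not vanish on a band of positive length.
  refine isGLB_csInf ⟨_, f, ⟨hG.mem_bandLimited, ?_⟩, rfl⟩ ⟨-2, ?_⟩
  · rintro rfl
    have h1 := hG.integral_norm_sq_time
    simp only [Pi.zero_apply, norm_zero, ne_eq, OfNat.ofNat_ne_zero, not_false_eq_true, zero_pow,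
      integral_zero] at h1
    have h2 := (integral_eq_zero_iff_of_nonneg (fun t => by positivity)
      hG.integrable_norm_sq).1 h1.symm
    have h3 : ∀ᵐ ν ∂(volume.restrict (Set.Icc (-halfBand T γ) (halfBand T γ))), False := by
      filter_upwards [hne, ae_restrict_of_ae h2] with ν h4 h5
      exact h4 (by simpa using h5)
    rw [ae_iff] at h3
    simp only [not_false_eq_true, Measure.restrict_apply_univ, Real.volume_Icc,
      ENNReal.ofReal_eq_zero, Set.ofPred_true] at h3
    linarith
  · rintro _ ⟨u, ⟨⟨-, H, hH⟩, hu0⟩, rfl⟩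
    exact hH.neg_two_le_Phi hT hW hu0

/-! ### Zero excess bandwidth -/

/-- Only correlations of `G` with its translate by `1 / T` could contribute, and a band of length `1
/ T` meets its translate in a single point. -/
theorem IsSpectrum.integral_norm_sq_mul_osc_eq_zero (h : IsSpectrum (1 / (2 * T)) G f) (hT : 0 < T)
    {l : ℤ} (hl : l ≠ 0) : ∫ t, ((‖f t‖ ^ 2 : ℝ) : ℂ) * osc (-(l * t / T)) = 0 := by
  have hW : 1 / (2 * T) ≤ (1 : ℕ) / T := by
    rw [Nat.cast_one]
    exact one_div_le_one_div_of_le hT (by linarith)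
  have hW' : 1 / (2 * T) = 1 / T / 2 := by rw [div_div, mul_comm]
  rw [h.integral_norm_sq_mul_osc hT hW l]
  refine mul_eq_zero_of_right _ (Finset.sum_eq_zero fun k hk => Finset.sum_eq_zero fun j hj => ?_)
  split_ifs with hkj
  swap
  · rfl
  rw [corrCoeff]
  refine mul_eq_zero_of_right _ (intervalIntegral.integral_zero_ae ?_)
  -- The point `1 / (2 T)` is the only one at which both factors may be nonzero.
  have hae : ∀ᵐ ν ∂(volume : Measure ℝ), ν ≠ 1 / T / 2 := by
    rw [ae_iff]; simp
  filter_upwards [hae] with ν hν _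
  have key : G ν = 0 ∨ G (ν + -(1 / T)) = 0 := by
    by_contra! hc
    have h1 : ν ∈ Set.Icc (-(1 / (2 * T))) (1 / (2 * T)) := by
      by_contra h1; exact hc.1 (h.2.1 _ h1)
    have h2 : ν + -(1 / T) ∈ Set.Icc (-(1 / (2 * T))) (1 / (2 * T)) := by
      by_contra h2; exact hc.2 (h.2.1 _ h2)
    rw [hW'] at h1 h2
    exact hν (by linarith [h1.2, h2.1])
  have e0 : foldShift T 1 0 = -(1 / T) := by simp [foldShift, neg_div]
  have e1 : foldShift T 1 1 = 0 := by simp [foldShift]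
  simp only [mul_one, Finset.mem_range] at hk hj
  have hcase : (k = 0 ∧ j = 1) ∨ (k = 1 ∧ j = 0) := by omega
  rcases hcase with ⟨rfl, rfl⟩ | ⟨rfl, rfl⟩ <;> rw [e0, e1, add_zero] <;>
    rcases key with hz | hz <;> rw [hz] <;> simp

theorem cyclicInt_eq_zero (hT : 0 < T) (hf : f ∈ bandLimited (1 / (2 * T))) {l : ℤ} (hl : l ≠ 0) :
    cyclicInt (l / T) f = 0 := by
  obtain ⟨-, G, h⟩ := hf
  rw [cyclicInt_eq, h.integral_norm_sq_mul_osc_eq_zero hT hl]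

theorem ncCyclicInt_eq_zero (hT : 0 < T) (hf : f ∈ bandLimited (1 / (2 * T))) {l : ℤ}
    (hl : l ≠ 0) : ncCyclicInt (l / T) f = 0 := by
  obtain ⟨-, G, h⟩ := hf
  rw [ncCyclicInt_eq, h.integral_sq_mul_osc,
    (h.add h.conjugate).integral_norm_sq_mul_osc_eq_zero hT hl,
    (h.add (h.conjugate.const_mul (-1))).integral_norm_sq_mul_osc_eq_zero hT hl,
    (h.add (h.conjugate.const_mul I)).integral_norm_sq_mul_osc_eq_zero hT hl,
    (h.add (h.conjugate.const_mul (-I))).integral_norm_sq_mul_osc_eq_zero hT hl]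
  simp

theorem cyclic_terms_eq_zero (hT : 0 < T) (hf : f ∈ bandLimited (1 / (2 * T))) :
    cyclicInt (1 / T) f = 0 ∧ ncCyclicInt (1 / T) f = 0 ∧ ncCyclicInt (-(1 / T)) f = 0 := by
  have h1 := cyclicInt_eq_zero hT hf (l := 1) one_ne_zero
  have h2 := ncCyclicInt_eq_zero hT hf (l := 1) one_ne_zero
  have h3 := ncCyclicInt_eq_zero hT hf (l := -1) (by norm_num)
  simp only [Int.cast_one, Int.cast_neg, neg_div] at h1 h2 h3
  exact ⟨h1, h2, h3⟩

theorem Phi_eq_PhiZero (hT : 0 < T) (hf : f ∈ bandLimited (1 / (2 * T))) :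
    Phi T f = PhiZero T f := by
  obtain ⟨h1, h2, h3⟩ := cyclic_terms_eq_zero hT hf
  rw [Phi, PhiZero, h1, h2, h3]
  simp

end statistics

end CMA

end

/-! ### The proposition -/

theorem mainTheorem4
    {Ω : Type*} [MeasurableSpace Ω] (μ : Measure Ω) [IsProbabilityMeasure μ]
    (a : ℤ → Ω → ℂ) (ha : CMA.IsBPSK a μ)
    (T : ℝ) (hT : 0 < T) (Te : ℝ → ℝ) (g : ℝ → ℝ → ℂ)
    (hTe : ∀ γ ∈ Set.Ico (0 : ℝ) 1, CMA.IsSamplingPeriod T γ (Te γ))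
    (hg : ∀ γ ∈ Set.Ico (0 : ℝ) 1, CMA.IsShapingFilter T γ (g γ)) :
    (∀ γ ∈ Set.Ico (0 : ℝ) 1,
      IsGLB (CMA.Phi T '' {f | f ∈ CMA.bandLimited (CMA.halfBand T γ) ∧ f ≠ 0})
        (CMA.betaMin T (Te γ) (g γ) ha.symbol)) ∧
    AntitoneOn (fun γ => CMA.betaMin T (Te γ) (g γ) ha.symbol) (Set.Ico (0 : ℝ) 1) ∧
    ((∀ γ ∈ Set.Ico (0 : ℝ) 1, CMA.betaMin T (Te γ) (g γ) ha.symbol < 2) ↔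
      CMA.betaMin T (Te 0) (g 0) ha.symbol < 2) ∧
    (∀ f ∈ CMA.bandLimited (1 / (2 * T)),
      CMA.cyclicInt (1 / T) f = 0 ∧ CMA.ncCyclicInt (1 / T) f = 0 ∧
        CMA.ncCyclicInt (-(1 / T)) f = 0) ∧
    IsGLB (CMA.PhiZero T '' {f | f ∈ CMA.bandLimited (1 / (2 * T)) ∧ f ≠ 0})
      (CMA.betaMin T (Te 0) (g 0) ha.symbol) := by
  have hglb : ∀ γ ∈ Set.Ico (0 : ℝ) 1,
      IsGLB (CMA.Phi T '' {f | f ∈ CMA.bandLimited (CMA.halfBand T γ) ∧ f ≠ 0})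
        (CMA.betaMin T (Te γ) (g γ) ha.symbol) := fun γ hγ =>
    CMA.isGLB_betaMin ha hT hγ (hTe γ hγ) (hg γ hγ)
  have hanti : AntitoneOn (fun γ => CMA.betaMin T (Te γ) (g γ) ha.symbol) (Set.Ico (0 : ℝ) 1) := by
    intro γ hγ γ' hγ' hle
    -- A wider band enlarges the set of admissible filters, so its greatest lower bound cannot
    -- increase.
    refine (hglb γ hγ).mono (hglb γ' hγ') (Set.image_mono fun f hf => ⟨?_, hf.2⟩)
    refine CMA.bandLimited_mono ?_ hf.1
    unfold CMA.halfBand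
    gcongr
  have h0 : (0 : ℝ) ∈ Set.Ico (0 : ℝ) 1 := by simp
  refine ⟨hglb, hanti, ⟨fun h => h 0 h0, fun h γ hγ => (hanti h0 hγ hγ.1).trans_lt h⟩,
    fun f hf => CMA.cyclic_terms_eq_zero hT hf, ?_⟩
  have hband : CMA.halfBand T 0 = 1 / (2 * T) := by rw [CMA.halfBand, add_zero]
  have h1 := hglb 0 h0
  rw [hband] at h1
  rwa [Set.image_congr fun f hf => CMA.Phi_eq_PhiZero hT hf.1] at h1
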